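/- Let $d\ge 1$, $\alpha>0$, $t\in[1,2]$, $\eta\in(0,1)$. With $m=\lceil\alpha\rceil-1$, let $H(\alpha,L)$ be the set of $m$ times differentiable $f:\mathbb R^d\to\mathbb R$ such that $|f(y)-P_f(x,y-x)|\le L\|x-y\|^\alpha$ for all $x,y$, where $P_f(x,\cdot)$ is the Taylor polynomial of degree $m$ of $f$ at $x$. Let $\mathcal P(\alpha,L,c_\star)$ be the set of probability densities $p\in H(\alpha,L)$ on $\mathbb R^d$ with $|p(x)-p(y)|\le c_\star p(x)+L\|x-y\|^\alpha$ for all $x,y$. Write $\mathbb P_p$ for the law of $n=2k$ ($k\ge1$) i.i.d. observations $X_1,\dots,X_n$ with density $p$. Fix constants $c_{aux},c_B,C_{BT}>0$ and a bounded measurable kernel $K:\mathbb R^d\to\mathbb R$ that vanishes outside $\{\|x\|\le \frac12\}$ and is of order $\alpha$: for some constant $C_K$, $\|f-K_h*f\|_\infty\le C_KLh^\alpha$ for all $L,h>0$ and $f\in H(\alpha,L)$, where $K_h(x)=h^{-d}K(x/h)$. For $p_0\in\mathcal P(\alpha,L,c_\star)$ and $u\in[0,\infty]$ put $\mathcal B(u)=\{p_0\ge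 u\}$, $\mathcal T(u)=\{p_0<u\}$, $\widetilde L=L^d/n^{2\alpha}$, $r=\frac{2\alpha t}{(4-t)\alpha+d}$, $$u_{aux}=\sup\Big\{u\ge0:\ \frac{\int_{\mathcal T(u)}p_0^2}{\big(\int_{\mathcal T(u)}p_0\big)^{d/(\alpha+d)}}\le c_{aux}\widetilde L^{\frac1{\alpha+d}}\Big\},\qquad \mathcal I=\int_{\mathcal B(u_{aux})}p_0^r,$$ (with $0/0=0$), $$u_B=\max\left(u_{aux},\ \Big[c_B\frac{L^{d/(4\alpha+d)}}{(n^2\mathcal I)^{\alpha/(4\alpha+d)}}\Big]^{\frac{(4-t)\alpha+d}{(2-t)\alpha+d}}\right),$$ $$\rho^*_{bulk}=\big[\widetilde L\,\mathcal I^{2\alpha/r}\big]^{\frac1{4\alpha+d}},\qquad \rho^*_{tail}=\Big[\widetilde L^{t-1}\Big(\int_{\mathcal T(u_B)}p_0\Big)^{(2-t)\alpha+d}\Big]^{\frac1{t(\alpha+d)}}.$$ Let $\widetilde{\mathcal B}=\mathcal B(u_B/2)$ if $C_{BT}\rho^*_{bulk}\ge\rho^*_{tail}$ and $\widetilde{\mathcal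 B}=\mathcal B(u_B)$ otherwise. On $\widetilde{\mathcal B}$ define $$h_b(x)=\frac{p_0(x)^{\frac{2}{(4-t)\alpha+d}}}{(n^2L^4\mathcal I)^{\frac1{4\alpha+d}}},\quad h(x)=c_hh_b(x),\quad c_h=\Big(\tfrac14\,2^{\frac{2\alpha}{(4-t)\alpha+d}-1}c_B\Big)^{1/\alpha},\quad \omega(x)=p_0(x)^{\frac{2\alpha t-4\alpha}{(4-t)\alpha+d}},$$ $$\hat p(x)=\frac1k\sum_{i=1}^kK_{h(x)}(x-X_i),\qquad \hat p'(x)=\frac1k\sum_{i=k+1}^{2k}K_{h(x)}(x-X_i),$$ $$T_{bulk}=\int_{\widetilde{\mathcal B}}\omega(x)\,[\hat p(x)-p_0(x)]\,[\hat p'(x)-p_0(x)]\,dx,\qquad \psi^*_{bulk}=\mathbb 1\{T_{bulk}>C_{\psi_b}t_n\},\qquad t_n=C_{t_n}\frac{L^{\frac{2d}{4\alpha+d}}\mathcal I^{\frac{2\alpha+d}{4\alpha+d}}}{n^{\frac{4\alpha}{4\alpha+d}}}.$$ For $\delta\in(0,1)$ and $\rho>0$ let $$\mathcal P_{Bulk}(\rho)=\Big\{p\in\mathcal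 P\big(\alpha,(1+\delta)L,(1+\delta)c_\star\big):\ \int_{\widetilde{\mathcal B}}|p-p_0|^t\ge\rho^t\Big\}.$$ Proposition. For all sufficiently large constants $C_{t_n}$ and $C_{\psi_b}$ there is a constant $C'_b>0$ such that, for all $L>0$, $\delta\in(0,1)$, $c_\star\in(0,\frac12)$, $k\ge1$ and all $p_0\in\mathcal P(\alpha,L,c_\star)$ with $\rho^*_{bulk}>0$, $$\mathbb P_{p_0}(\psi^*_{bulk}=1)+\sup_{p\in\mathcal P_{Bulk}(C'_b\rho^*_{bulk})}\mathbb P_p(\psi^*_{bulk}=0)\le\frac\eta2 ,$$ where the supremum over an empty set is $0$. How large $C_{t_n}$ and $C_{\psi_b}$ must be depends only on $\eta,\alpha,t,d$ and on the fixed choices $K,c_{aux},c_B,C_{BT}$, and $C'_b$ depends only on these, $C_{t_n}$ and $C_{\psi_b}$ (never on $n,L,\delta,c_\star,p_0$). -/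

import Mathlib

open MeasureTheory
open scoped ENNReal

noncomputable section

namespace BulkTest

/-- Euclidean space `ℝ^d`, with its Euclidean norm and Lebesgue measure. -/
abbrev Space (d : ℕ) : Type := EuclideanSpace ℝ (Fin d)

/-! ### Hölder classes and densities -/

/-- The increment `z ↦ P_f(x, z)` of the Taylor polynomial of degree `m` of `f` at `x`:
`P_f(x, z) = ∑_{j ≤ m} D^j f(x)[z, …, z] / j!`. -/
def taylorPoly {d : ℕ} (m : ℕ) (f : Space d → ℝ) (x z : Space d) : ℝ :=
  ∑ j ∈ Finset.range (m + 1), (iteratedFDeriv ℝ j f x fun _ => z) / (j.factorial : ℝ)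

/-- The Hölder class `H(α, L)` on `ℝ^d`: with `m = ⌈α⌉ - 1`, the functions that are `m` times
differentiable and satisfy `|f(y) - P_f(x, y - x)| ≤ L ‖x - y‖^α` for all `x, y`. -/
def holderClass (d : ℕ) (α L : ℝ) : Set (Space d → ℝ) :=
  {f | (∀ j < ⌈α⌉₊ - 1, Differentiable ℝ (iteratedFDeriv ℝ j f)) ∧
    ∀ x y, |f y - taylorPoly (⌈α⌉₊ - 1) f x (y - x)| ≤ L * ‖x - y‖ ^ α}

/-- The class `𝒫(α, L, c⋆)`: probability densities in `H(α, L)` such that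
`|p(x) - p(y)| ≤ c⋆ p(x) + L ‖x - y‖^α` for all `x, y`. -/
def densityClass (d : ℕ) (α L cStar : ℝ) : Set (Space d → ℝ) :=
  {p | p ∈ holderClass d α L ∧ (∀ x, 0 ≤ p x) ∧ Integrable p ∧ ∫ x, p x = 1 ∧
    ∀ x y, |p x - p y| ≤ cStar * p x + L * ‖x - y‖ ^ α}

/-- The law `ℙ_p` of `n` i.i.d. observations with density `p`. -/
def sampleLaw {d : ℕ} (n : ℕ) (p : Space d → ℝ) : Measure (Fin n → Space d) :=
  Measure.pi fun _ => volume.withDensity fun x => ENNReal.ofReal (p x)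

/-! ### Bulk, tail and cut-offs

The cut-offs are extended nonnegative reals: the supremum defining `uAux` may be infinite. -/

/-- `ℬ(u) = {p₀ ≥ u}`. -/
def bulkSet {d : ℕ} (p₀ : Space d → ℝ) (u : ℝ≥0∞) : Set (Space d) :=
  {x | u ≤ ENNReal.ofReal (p₀ x)}

/-- `𝒯(u) = {p₀ < u}`. -/
def tailSet {d : ℕ} (p₀ : Space d → ℝ) (u : ℝ≥0∞) : Set (Space d) :=
  {x | ENNReal.ofReal (p₀ x) < u}

/-- `L̃ = L^d / n^{2α}`. -/
def LTilde (d n : ℕ) (α L : ℝ) : ℝ := L ^ d / (n : ℝ) ^ (2 * α)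

/-- `r = 2αt / ((4 - t)α + d)`. -/
def rExp (d : ℕ) (α t : ℝ) : ℝ := 2 * α * t / ((4 - t) * α + d)

/-- `u_aux = sup {u ≥ 0 : p₀²[𝒯(u)] / p₀[𝒯(u)]^{d/(α+d)} ≤ c_aux L̃^{1/(α+d)}}`. -/
def uAux {d : ℕ} (n : ℕ) (α L cAux : ℝ) (p₀ : Space d → ℝ) : ℝ≥0∞ :=
  sSup {u : ℝ≥0∞ | u ≠ ∞ ∧
    (∫ x in tailSet p₀ u, p₀ x ^ 2) / (∫ x in tailSet p₀ u, p₀ x) ^ ((d : ℝ) / (α + d)) ≤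
      cAux * LTilde d n α L ^ (1 / (α + d))}

/-- `ℐ = ∫_{ℬ(u_aux)} p₀^r`. -/
def bulkI {d : ℕ} (n : ℕ) (α t L cAux : ℝ) (p₀ : Space d → ℝ) : ℝ :=
  ∫ x in bulkSet p₀ (uAux n α L cAux p₀), p₀ x ^ rExp d α t

/-- `u_B`, the maximum of `u_aux` and
`[c_B L^{d/(4α+d)} / (n² ℐ)^{α/(4α+d)}]^{((4-t)α+d)/((2-t)α+d)}` (used only when `ℐ > 0`). -/
def uB {d : ℕ} (n : ℕ) (α t L cAux cB : ℝ) (p₀ : Space d → ℝ) : ℝ≥0∞ :=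
  max (uAux n α L cAux p₀)
    (ENNReal.ofReal
      ((cB * (L ^ ((d : ℝ) / (4 * α + d)) /
          ((n : ℝ) ^ 2 * bulkI n α t L cAux p₀) ^ (α / (4 * α + d)))) ^
        (((4 - t) * α + d) / ((2 - t) * α + d))))

/-- `ρ*_bulk = [L̃ ‖p₀ 𝟙_{ℬ(u_aux)}‖_r^{2α}]^{1/(4α+d)}`. -/
def rhoBulk {d : ℕ} (n : ℕ) (α t L cAux : ℝ) (p₀ : Space d → ℝ) : ℝ :=
  (LTilde d n α L * (bulkI n α t L cAux p₀ ^ (1 / rExp d α t)) ^ (2 * α)) ^ (1 / (4 * α + d))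

/-- `ρ*_tail = [L̃^{t-1} p₀[𝒯(u_B)]^{(2-t)α+d}]^{1/(t(α+d))}`. -/
def rhoTail {d : ℕ} (n : ℕ) (α t L cAux cB : ℝ) (p₀ : Space d → ℝ) : ℝ :=
  (LTilde d n α L ^ (t - 1) *
    (∫ x in tailSet p₀ (uB n α t L cAux cB p₀), p₀ x) ^ ((2 - t) * α + d)) ^ (1 / (t * (α + d)))

open Classical in
/-- The cut-off `ũ` of the set on which the test is built: `u_B / 2` if the bulk dominates, that is
if `C_BT ρ*_bulk ≥ ρ*_tail`, and `u_B` otherwise. -/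
def uTilde {d : ℕ} (n : ℕ) (α t L cAux cB CBT : ℝ) (p₀ : Space d → ℝ) : ℝ≥0∞ :=
  if rhoTail n α t L cAux cB p₀ ≤ CBT * rhoBulk n α t L cAux p₀ then
    uB n α t L cAux cB p₀ / 2
  else uB n α t L cAux cB p₀

/-- `ℬ̃ = ℬ(ũ)`. -/
def bulkTilde {d : ℕ} (n : ℕ) (α t L cAux cB CBT : ℝ) (p₀ : Space d → ℝ) : Set (Space d) :=
  bulkSet p₀ (uTilde n α t L cAux cB CBT p₀)

/-! ### Kernel estimators and the test -/

/-- `K_h(x) = h^{-d} K(x / h)`. -/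
def scaledKernel {d : ℕ} (K : Space d → ℝ) (h : ℝ) (x : Space d) : ℝ :=
  (1 / h ^ d) * K (h⁻¹ • x)

/-- Admissible kernels: bounded, vanishing outside the Euclidean ball of radius `1/2`, and of order
`α`, in the sense that `‖f - K_h * f‖_∞ ≤ C_K L h^α` for all `f ∈ H(α, L)` and `h > 0`, for some
constant `C_K`. -/
structure IsKernel {d : ℕ} (α : ℝ) (K : Space d → ℝ) : Prop where
  measurable : Measurable K
  bounded : ∃ M : ℝ, ∀ x, |K x| ≤ M
  support : ∀ x, 1 / 2 < ‖x‖ → K x = 0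
  order : ∃ CK : ℝ, ∀ L : ℝ, 0 < L → ∀ f ∈ holderClass d α L, ∀ h : ℝ, 0 < h → ∀ x,
    |f x - ∫ y, scaledKernel K h (x - y) * f y| ≤ CK * L * h ^ α

/-- `h_b(x) = p₀(x)^{2/((4-t)α+d)} / (n² L⁴ ℐ)^{1/(4α+d)}`. -/
def hBulk {d : ℕ} (n : ℕ) (α t L cAux : ℝ) (p₀ : Space d → ℝ) (x : Space d) : ℝ :=
  p₀ x ^ (2 / ((4 - t) * α + d)) /
    ((n : ℝ) ^ 2 * L ^ 4 * bulkI n α t L cAux p₀) ^ (1 / (4 * α + d))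

/-- `c_h = (c̃ / 4)^{1/α}` with `c̃ = 2^{2α/((4-t)α+d) - 1} c_B`. -/
def cH (d : ℕ) (α t cB : ℝ) : ℝ :=
  ((2 : ℝ) ^ (2 * α / ((4 - t) * α + d) - 1) * cB / 4) ^ (1 / α)

/-- The bandwidth `h(x) = c_h h_b(x)`. -/
def bandwidth {d : ℕ} (n : ℕ) (α t L cAux cB : ℝ) (p₀ : Space d → ℝ) (x : Space d) : ℝ :=
  cH d α t cB * hBulk n α t L cAux p₀ x

/-- The kernel estimator at `x` with bandwidth `h`, built on the `k` observations whose indices lie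
in the batch `S`: `(1/k) ∑_{i ∈ S} K_h(x - X_i)`. -/
def kernelEstimator {d k : ℕ} (K : Space d → ℝ) (S : Finset (Fin (2 * k))) (h : ℝ)
    (X : Fin (2 * k) → Space d) (x : Space d) : ℝ :=
  (1 / (k : ℝ)) * ∑ i ∈ S, scaledKernel K h (x - X i)

/-- Indices of the first half of the sample. -/
def firstHalf (k : ℕ) : Finset (Fin (2 * k)) := Finset.univ.filter fun i => i.val < k

/-- Indices of the second half of the sample. -/
def secondHalf (k : ℕ) : Finset (Fin (2 * k)) := Finset.univ.filter fun i => k ≤ i.val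

/-- The weight `ω(x) = p₀(x)^{(2αt - 4α)/((4-t)α+d)}`. -/
def weight {d : ℕ} (α t : ℝ) (p₀ : Space d → ℝ) (x : Space d) : ℝ :=
  p₀ x ^ ((2 * α * t - 4 * α) / ((4 - t) * α + d))

/-- `T_bulk = ∫_{ℬ̃} ω (p̂ - p₀) (p̂' - p₀)`, for a sample of size `n = 2k`. -/
def tBulk {d k : ℕ} (α t L cAux cB CBT : ℝ) (K p₀ : Space d → ℝ)
    (X : Fin (2 * k) → Space d) : ℝ :=
  ∫ x in bulkTilde (2 * k) α t L cAux cB CBT p₀,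
    weight α t p₀ x *
      (kernelEstimator K (firstHalf k) (bandwidth (2 * k) α t L cAux cB p₀ x) X x - p₀ x) *
      (kernelEstimator K (secondHalf k) (bandwidth (2 * k) α t L cAux cB p₀ x) X x - p₀ x)

/-- `t_n = C_{t_n} L^{2d/(4α+d)} ℐ^{(2α+d)/(4α+d)} / n^{4α/(4α+d)}`. -/
def tThreshold {d : ℕ} (n : ℕ) (α t L cAux Ctn : ℝ) (p₀ : Space d → ℝ) : ℝ :=
  Ctn * (L ^ (2 * (d : ℝ) / (4 * α + d)) *
    bulkI n α t L cAux p₀ ^ ((2 * α + d) / (4 * α + d)) / (n : ℝ) ^ (4 * α / (4 * α + d)))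

/-- The bulk test `ψ*_bulk = 𝟙{T_bulk > C_ψ t_n}`. -/
def psiBulk {d k : ℕ} (α t L cAux cB CBT Ctn Cpsi : ℝ) (K p₀ : Space d → ℝ)
    (X : Fin (2 * k) → Space d) : ℕ :=
  if Cpsi * tThreshold (2 * k) α t L cAux Ctn p₀ < tBulk α t L cAux cB CBT K p₀ X then 1 else 0

/-- `𝒫_Bulk(ρ) = {p ∈ 𝒫(α, (1+δ)L, (1+δ)c⋆) : ∫_{ℬ̃} |p - p₀|^t ≥ ρ^t}`. -/
def bulkAlternatives {d : ℕ} (n : ℕ) (α t L δ cStar cAux cB CBT : ℝ) (p₀ : Space d → ℝ)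
    (ρ : ℝ) : Set (Space d → ℝ) :=
  {p | p ∈ densityClass d α ((1 + δ) * L) ((1 + δ) * cStar) ∧
    ρ ^ t ≤ ∫ x in bulkTilde n α t L cAux cB CBT p₀, |p x - p₀ x| ^ t}

end BulkTest

end

/-!
The statistic is a split-sample U-statistic: with `P` the law of one observation, `h` the bandwidth
and `ω` the weight, `T = ∫ (ẑ - q)(ẑ' - q)` where `ẑ`, `ẑ'` are the empirical means over the two
halves of the sample of the functions `z(·, X_i) = √ω K_h(· - X_i)` restricted to the bulk `B`, and
`q = √ω p₀`. Its mean is `A = ∫_B ω (K_h * p - p₀)²`, and Hoeffding's decomposition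
(`splitStat_sub_eq`) bounds its mean square deviation from `A` by a multiple of `A √V + V`, with
`V = W / k²` and `W` the squared `L²(P ⊗ P)` norm of the Gram kernel `∫ z(x, u) z(x, v) dx`. The
linear terms need no separate estimate, because the operator norm of the covariance operator is at
most its Hilbert–Schmidt norm (`integral_sq_inner_le`, `integral_sq_splitStat_sub_le`).

On `B` the cut-off and the bandwidth are tuned so that `L h^α ≤ p₀ / 4`
(`bandwidth_le_of_cut`), hence `p₀` varies by a bounded factor at scale `h`. Cauchy–Schwarz then
gives `W ≤ C ∫_B ω² h^{-d} (p + p₀)²` (`LocalSetup.integral_sq_gram_locKernel_le`). Writing `τ` for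
the scale of the threshold (`sepScale`), the definitions give pointwise that the squared bias
`ω (L h^α)²` is of the order `(τ / ℐ) p₀^r` and that `ω² p₀² h^{-d} / n²` is of the order
`(τ² / ℐ) p₀^r`. Together with `L h^α ≤ p₀ / 4`, these yield `ω h^{-d} / n² ≤ C τ`. Since
`∫_B p₀^r ≤ C ℐ`, one gets, with `S = ∫_B ω (p - p₀)²`, that `V ≤ C τ (τ + S)` and that `A` and `S`
agree up to a factor `2` and an error of the order of `τ` (`BulkSetup.moments`).

The bound `∫_B p₀^r ≤ C ℐ` (`exists_setIntegral_bulkTilde_le`) is immediate when `B` lies above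
`u_aux`. When the bulk dominates and `B` is enlarged, `p₀^r ≤ v^{r-2} p₀²` for `p₀ ≥ v`, the integral
of `p₀²` over the tail is controlled by the definition of `u_aux`, and the remaining powers of `ℐ`
and `L̃` combine to exactly `ℐ` (`tail_contribution_le`).

Chebyshev's inequality concludes. Under `p₀` one has `S = 0`, so that mean and deviation are of the
order of `τ`, below the threshold. Under an alternative, Hölder's inequality turns the separation in
`L^t` into `S ≥ N τ` (`BulkSetup.le_sqDist_of_separated`), and the mean exceeds threshold and
deviation when `N` is large.
-/

noncomputable section

namespace BulkTest

/-! ### Bounded measurable functions -/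

/-- Bounded measurable real functions. They are stable under all the operations needed below,
parametric integrals included, and integrable for every finite measure. -/
def BddMeas {E : Type*} [MeasurableSpace E] (f : E → ℝ) : Prop :=
  Measurable f ∧ ∃ C : ℝ, ∀ x, |f x| ≤ C

namespace BddMeas

variable {E F : Type*} [MeasurableSpace E] [MeasurableSpace F]

lemma const (c : ℝ) : BddMeas (fun _ : E => c) := ⟨measurable_const, |c|, fun _ => le_rfl⟩

lemma add {f g : E → ℝ} (hf : BddMeas f) (hg : BddMeas g) : BddMeas (fun x => f x + g x) := by
  obtain ⟨hfm, C, hC⟩ := hf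
  obtain ⟨hgm, C', hC'⟩ := hg
  exact ⟨hfm.add hgm, C + C', fun x => (abs_add_le _ _).trans (add_le_add (hC x) (hC' x))⟩

lemma sub {f g : E → ℝ} (hf : BddMeas f) (hg : BddMeas g) : BddMeas (fun x => f x - g x) := by
  obtain ⟨hfm, C, hC⟩ := hf
  obtain ⟨hgm, C', hC'⟩ := hg
  exact ⟨hfm.sub hgm, C + C', fun x => (abs_sub _ _).trans (add_le_add (hC x) (hC' x))⟩

lemma mul {f g : E → ℝ} (hf : BddMeas f) (hg : BddMeas g) : BddMeas (fun x => f x * g x) := by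
  obtain ⟨hfm, C, hC⟩ := hf
  obtain ⟨hgm, C', hC'⟩ := hg
  refine ⟨hfm.mul hgm, C * C', fun x => ?_⟩
  rw [abs_mul]
  exact mul_le_mul (hC x) (hC' x) (abs_nonneg _) ((abs_nonneg _).trans (hC x))

lemma sq {f : E → ℝ} (hf : BddMeas f) : BddMeas (fun x => f x ^ 2) := by
  simpa only [pow_two] using hf.mul hf

lemma comp {f : F → ℝ} (hf : BddMeas f) {g : E → F} (hg : Measurable g) :
    BddMeas (fun x => f (g x)) :=
  ⟨hf.1.comp hg, hf.2.imp fun _ h x => h (g x)⟩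

lemma sum {ι : Type*} (s : Finset ι) {f : ι → E → ℝ} (hf : ∀ i ∈ s, BddMeas (f i)) :
    BddMeas (fun x => ∑ i ∈ s, f i x) := by
  classical
  induction s using Finset.induction_on with
  | empty => simpa using const (E := E) 0
  | insert i s hi ih =>
    simp only [Finset.sum_insert hi]
    exact (hf i (Finset.mem_insert_self _ _)).add
      (ih fun j hj => hf j (Finset.mem_insert_of_mem hj))

lemma integrable {f : E → ℝ} (hf : BddMeas f) (μ : Measure E) [IsFiniteMeasure μ] :
    Integrable f μ := by
  obtain ⟨hfm, C, hC⟩ := hf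
  exact Integrable.of_bound hfm.aestronglyMeasurable C (Filter.Eventually.of_forall hC)

lemma integral_right {f : E → F → ℝ} (hf : BddMeas (fun p : E × F => f p.1 p.2))
    (ν : Measure F) [IsFiniteMeasure ν] : BddMeas (fun x => ∫ y, f x y ∂ν) := by
  obtain ⟨hfm, C, hC⟩ := hf
  refine ⟨(StronglyMeasurable.integral_prod_right (ν := ν) (f := f)
    hfm.stronglyMeasurable).measurable, C * ν.real Set.univ, fun x => ?_⟩
  exact norm_integral_le_of_norm_le_const (f := fun y => f x y)
    (Filter.Eventually.of_forall fun y => hC (x, y))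

lemma swap {f : E → F → ℝ} (hf : BddMeas (fun p : E × F => f p.1 p.2)) :
    BddMeas (fun p : F × E => f p.2 p.1) :=
  hf.comp measurable_swap

lemma right {f : E → F → ℝ} (hf : BddMeas (fun p : E × F => f p.1 p.2)) (x : E) :
    BddMeas (fun y => f x y) :=
  hf.comp (g := fun y => (x, y)) measurable_prodMk_left

lemma integral_swap {f : E → F → ℝ} (hf : BddMeas (fun p : E × F => f p.1 p.2))
    (μ : Measure E) [IsFiniteMeasure μ] (ν : Measure F) [IsFiniteMeasure ν] :
    ∫ x, ∫ y, f x y ∂ν ∂μ = ∫ y, ∫ x, f x y ∂μ ∂ν :=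
  integral_integral_swap (hf.integrable (μ.prod ν))

end BddMeas

/-! ### Cauchy–Schwarz and orthogonality -/

section Hilbert

variable {E F : Type*} [MeasurableSpace E] [MeasurableSpace F]

lemma sq_integral_mul_le {μ : Measure E} {f g : E → ℝ} (hf : Integrable (fun x => f x ^ 2) μ)
    (hg : Integrable (fun x => g x ^ 2) μ) (hfg : Integrable (fun x => f x * g x) μ) :
    (∫ x, f x * g x ∂μ) ^ 2 ≤ (∫ x, f x ^ 2 ∂μ) * ∫ x, g x ^ 2 ∂μ := by
  have key : ∀ s : ℝ, 0 ≤ (∫ x, f x ^ 2 ∂μ) * (s * s) + (2 * ∫ x, f x * g x ∂μ) * s +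
      ∫ x, g x ^ 2 ∂μ := by
    intro s
    have h0 : 0 ≤ ∫ x, (s * f x + g x) ^ 2 ∂μ := integral_nonneg fun x => sq_nonneg _
    have h1 : ∫ x, (s * f x + g x) ^ 2 ∂μ =
        ∫ x, ((s * s) * f x ^ 2 + (2 * s) * (f x * g x) + g x ^ 2) ∂μ := by
      congr 1; ext x; ring
    rw [h1, integral_add (by exact (hf.const_mul _).add (hfg.const_mul _)) hg,
      integral_add (hf.const_mul _) (hfg.const_mul _), integral_const_mul, integral_const_mul] at h0
    linarith
  have := discrim_le_zero key
  unfold discrim at this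
  nlinarith

lemma integral_sq_sub_integral_le {P : Measure F} [IsProbabilityMeasure P] {f : F → ℝ}
    (hf : BddMeas f) : ∫ u, (f u - ∫ v, f v ∂P) ^ 2 ∂P ≤ ∫ u, f u ^ 2 ∂P := by
  have h1 : ∀ u, (f u - ∫ v, f v ∂P) ^ 2 =
      f u ^ 2 - (2 * ∫ v, f v ∂P) * f u + (∫ v, f v ∂P) ^ 2 := fun u => by ring
  simp only [h1]
  rw [integral_add (by exact (hf.sq.integrable P).sub ((hf.integrable P).const_mul _))
    (integrable_const _), integral_sub (hf.sq.integrable P) ((hf.integrable P).const_mul _),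
    integral_const_mul, integral_const]
  simp only [probReal_univ, one_smul]
  nlinarith [sq_nonneg (∫ v, f v ∂P)]

lemma integral_sum_sq_of_orthogonal {Ω ι : Type*} [MeasurableSpace Ω] {Q : Measure Ω}
    [IsFiniteMeasure Q] (s : Finset ι) {Y : ι → Ω → ℝ} (hY : ∀ i ∈ s, BddMeas (Y i))
    (h : ∀ i ∈ s, ∀ j ∈ s, i ≠ j → ∫ X, Y i X * Y j X ∂Q = 0) :
    ∫ X, (∑ i ∈ s, Y i X) ^ 2 ∂Q = ∑ i ∈ s, ∫ X, Y i X ^ 2 ∂Q := by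
  simp only [pow_two, Finset.sum_mul_sum]
  rw [integral_finsetSum _ fun i hi =>
    (BddMeas.sum s fun j hj => (hY i hi).mul (hY j hj)).integrable Q]
  refine Finset.sum_congr rfl fun i hi => ?_
  rw [integral_finsetSum _ fun j hj => ((hY i hi).mul (hY j hj)).integrable Q]
  exact Finset.sum_eq_single i (fun j hj hji => h i hi j hj hji.symm) fun hi' => absurd hi hi'

end Hilbert

/-! ### Sums over independent coordinates -/

section Product

variable {F ι : Type*} [MeasurableSpace F] [Fintype ι] [DecidableEq ι] (P : Measure F)
  [IsProbabilityMeasure P]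

/-- Resampling one coordinate of an i.i.d. sample does not change its law. -/
lemma measurePreserving_update (l : ι) :
    MeasurePreserving (fun q : (ι → F) × F => Function.update q.1 l q.2)
      ((Measure.pi fun _ => P).prod P) (Measure.pi fun _ : ι => P) := by
  have hm : Measurable (fun q : (ι → F) × F => Function.update q.1 l q.2) := by
    refine measurable_pi_iff.2 fun i => ?_
    by_cases h : i = l
    · subst h; simpa using measurable_snd
    · simp only [Function.update_of_ne h]
      exact (measurable_pi_apply i).comp measurable_fst
  refine ⟨hm, (Measure.pi_eq fun s hs => ?_).symm⟩
  rw [Measure.map_apply hm (MeasurableSet.univ_pi hs)]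
  have : (fun q : (ι → F) × F => Function.update q.1 l q.2) ⁻¹' (Set.univ.pi s) =
      (Set.univ.pi (Function.update s l Set.univ)) ×ˢ s l := by
    ext q
    simp only [Set.mem_preimage, Set.mem_pi, Set.mem_univ, true_imp_iff, Set.mem_prod]
    constructor
    · intro h
      refine ⟨fun i => ?_, by simpa using h l⟩
      by_cases hi : i = l
      · subst hi; simp
      · simpa [Function.update_of_ne hi] using h i
    · rintro ⟨h, hl⟩ i
      by_cases hi : i = l
      · subst hi; simpa using hl
      · simpa [Function.update_of_ne hi] using h i
  rw [this, Measure.prod_prod, Measure.pi_pi, ← Finset.prod_erase_mul _ _ (Finset.mem_univ l),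
    ← Finset.prod_erase_mul Finset.univ (fun i => P (s i)) (Finset.mem_univ l)]
  simp only [Function.update_self, measure_univ, mul_one]
  congr 1
  refine Finset.prod_congr rfl fun i hi => ?_
  rw [Function.update_of_ne (Finset.ne_of_mem_erase hi)]

lemma integral_pi_update {H : (ι → F) → ℝ} (hH : BddMeas H) (l : ι) :
    ∫ X, H X ∂(Measure.pi fun _ : ι => P) =
      ∫ X, ∫ u, H (Function.update X l u) ∂P ∂(Measure.pi fun _ : ι => P) := by
  have hmp := measurePreserving_update (ι := ι) P l
  conv_lhs => rw [← hmp.map_eq]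
  rw [integral_map hmp.measurable.aemeasurable hH.1.aestronglyMeasurable]
  exact integral_prod _ ((hH.comp hmp.measurable).integrable _)

lemma integral_pi_eval {f : F → ℝ} (hf : BddMeas f) (i : ι) :
    ∫ X, f (X i) ∂(Measure.pi fun _ : ι => P) = ∫ u, f u ∂P := by
  rw [integral_pi_update P (hf.comp (measurable_pi_apply i)) i]
  simp

lemma integral_pi_eval_pair {g : F → F → ℝ} (hg : BddMeas (fun p : F × F => g p.1 p.2)) {i j : ι}
    (hij : i ≠ j) :
    ∫ X, g (X i) (X j) ∂(Measure.pi fun _ : ι => P) = ∫ u, ∫ v, g u v ∂P ∂P := by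
  have hm : BddMeas (fun X : ι → F => g (X i) (X j)) :=
    hg.comp (g := fun X : ι → F => (X i, X j)) (by fun_prop)
  rw [integral_pi_update P hm j]
  simp only [Function.update_self, Function.update_of_ne hij]
  exact integral_pi_eval P (f := fun u => ∫ v, g u v ∂P) (hg.integral_right P) i

lemma integral_sum_eval_sq (S : Finset ι) {φ : F → ℝ} (hφ : BddMeas φ) (h0 : ∫ u, φ u ∂P = 0) :
    ∫ X, (∑ i ∈ S, φ (X i)) ^ 2 ∂(Measure.pi fun _ : ι => P) = S.card * ∫ u, φ u ^ 2 ∂P := by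
  have hm : ∀ i : ι, BddMeas (fun X : ι → F => φ (X i)) := fun i => hφ.comp (measurable_pi_apply i)
  rw [integral_sum_sq_of_orthogonal S (fun i _ => hm i)]
  · simp only [integral_pi_eval P hφ.sq, Finset.sum_const, nsmul_eq_mul]
  · intro i _ j _ hij
    rw [integral_pi_update P ((hm i).mul (hm j)) i]
    simp only [Function.update_self, Function.update_of_ne hij.symm]
    simp only [integral_mul_const, h0, zero_mul, integral_zero]

/-- The second moment of a two-sample degenerate U-statistic. -/
lemma integral_sum_eval_pair_sq {S S' : Finset ι} (hS : Disjoint S S') {γ : F → F → ℝ}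
    (hγ : BddMeas (fun p : F × F => γ p.1 p.2)) (h1 : ∀ u, ∫ v, γ u v ∂P = 0)
    (h2 : ∀ v, ∫ u, γ u v ∂P = 0) :
    ∫ X, (∑ e ∈ S ×ˢ S', γ (X e.1) (X e.2)) ^ 2 ∂(Measure.pi fun _ : ι => P) =
      S.card * S'.card * ∫ u, ∫ v, γ u v ^ 2 ∂P ∂P := by
  have hm : ∀ e : ι × ι, BddMeas (fun X : ι → F => γ (X e.1) (X e.2)) := fun e =>
    hγ.comp (g := fun X : ι → F => (X e.1, X e.2)) (by fun_prop)
  have hne : ∀ {i j}, i ∈ S → j ∈ S' → i ≠ j := fun hi hj hij =>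
    Finset.disjoint_left.1 hS hi (hij ▸ hj)
  rw [integral_sum_sq_of_orthogonal _ (fun e _ => hm e)]
  · rw [Finset.sum_congr rfl (g := fun _ => ∫ u, ∫ v, γ u v ^ 2 ∂P ∂P)]
    · simp [Finset.card_product]
    · intro e he
      rw [Finset.mem_product] at he
      exact integral_pi_eval_pair P (g := fun u v => γ u v ^ 2) hγ.sq (hne he.1 he.2)
  · rintro ⟨i, j⟩ he ⟨i', j'⟩ he' hee
    rw [Finset.mem_product] at he he'
    by_cases hi : i = i'
    · have hj : j ≠ j' := fun hj => hee (by rw [hi, hj])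
      rw [integral_pi_update P ((hm _).mul (hm _)) j]
      simp only [Function.update_self, Function.update_of_ne hj.symm,
        Function.update_of_ne (hne he.1 he.2), Function.update_of_ne (hne he'.1 he.2)]
      simp only [integral_mul_const, h1, zero_mul, integral_zero]
    · rw [integral_pi_update P ((hm _).mul (hm _)) i]
      simp only [Function.update_self, Function.update_of_ne (Ne.symm hi),
        Function.update_of_ne (hne he.1 he.2).symm, Function.update_of_ne (hne he.1 he'.2).symm]
      simp only [integral_mul_const, h2, zero_mul, integral_zero]

end Product

/-! ### Moments of the split-sample quadratic statistic -/

section SplitSample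

variable {E F : Type*} [MeasurableSpace E] [MeasurableSpace F]

lemma integral_sq_integral_mul {μ : Measure E} [IsFiniteMeasure μ] {P : Measure F}
    [IsFiniteMeasure P] {f : E → F → ℝ} (hf : BddMeas (fun p : E × F => f p.1 p.2)) {g : F → ℝ}
    (hg : BddMeas g) :
    ∫ x, (∫ u, g u * f x u ∂P) ^ 2 ∂μ =
      ∫ u, ∫ v, g u * g v * ∫ x, f x u * f x v ∂μ ∂P ∂P := by
  have hgf : BddMeas (fun p : E × F => g p.2 * f p.1 p.2) := (hg.comp measurable_snd).mul hf
  have hb : BddMeas (fun x => ∫ v, g v * f x v ∂P) := hgf.integral_right P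
  calc ∫ x, (∫ u, g u * f x u ∂P) ^ 2 ∂μ
      = ∫ x, ∫ u, (g u * f x u) * (∫ v, g v * f x v ∂P) ∂P ∂μ := by
        simp only [integral_mul_const, pow_two]
    _ = ∫ u, ∫ x, (g u * f x u) * (∫ v, g v * f x v ∂P) ∂μ ∂P :=
        BddMeas.integral_swap (f := fun x u => (g u * f x u) * (∫ v, g v * f x v ∂P))
          (hgf.mul (hb.comp measurable_fst)) μ P
    _ = ∫ u, ∫ x, ∫ v, g u * g v * (f x u * f x v) ∂P ∂μ ∂P := by
        refine integral_congr_ae (Filter.Eventually.of_forall fun u => ?_)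
        refine integral_congr_ae (Filter.Eventually.of_forall fun x => ?_)
        simp only [← integral_const_mul]
        refine integral_congr_ae (Filter.Eventually.of_forall fun v => ?_)
        simp only
        ring
    _ = ∫ u, ∫ v, ∫ x, g u * g v * (f x u * f x v) ∂μ ∂P ∂P := by
        refine integral_congr_ae (Filter.Eventually.of_forall fun u => ?_)
        have hu : BddMeas (fun x => f x u) := hf.comp (g := fun x => (x, u)) (by fun_prop)
        exact BddMeas.integral_swap (f := fun x v => g u * g v * (f x u * f x v))
          ((((BddMeas.const (g u)).mul (hg.comp measurable_snd))).mul
            ((hu.comp measurable_fst).mul hf)) μ P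
    _ = _ := by simp only [integral_const_mul]

lemma BddMeas.gram {f : E → F → ℝ} (hf : BddMeas (fun p : E × F => f p.1 p.2)) (μ : Measure E)
    [IsFiniteMeasure μ] : BddMeas (fun p : F × F => ∫ x, f x p.1 * f x p.2 ∂μ) :=
  BddMeas.integral_right (f := fun (p : F × F) x => f x p.1 * f x p.2)
    ((hf.comp (g := fun p : (F × F) × E => (p.2, p.1.1)) (by fun_prop)).mul
      (hf.comp (g := fun p : (F × F) × E => (p.2, p.1.2)) (by fun_prop))) μ

/-- The operator norm of the covariance operator of the random function `f(·, u)`, `u ∼ P`, is at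
most its Hilbert–Schmidt norm, which is the `L²` norm of the Gram kernel. -/
lemma integral_sq_inner_le {μ : Measure E} [IsFiniteMeasure μ] {P : Measure F}
    [IsFiniteMeasure P] {f : E → F → ℝ} (hf : BddMeas (fun p : E × F => f p.1 p.2)) {a : E → ℝ}
    (ha : BddMeas a) :
    ∫ u, (∫ x, a x * f x u ∂μ) ^ 2 ∂P ≤
      (∫ x, a x ^ 2 ∂μ) * √(∫ u, ∫ v, (∫ x, f x u * f x v ∂μ) ^ 2 ∂P ∂P) := by
  set φ : F → ℝ := fun u => ∫ x, a x * f x u ∂μ with hφ_def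
  set W := ∫ u, ∫ v, (∫ x, f x u * f x v ∂μ) ^ 2 ∂P ∂P with hW
  have haf : BddMeas (fun p : E × F => a p.1 * f p.1 p.2) := (ha.comp measurable_fst).mul hf
  have hφ : BddMeas φ := BddMeas.integral_right (f := fun u x => a x * f x u)
    (BddMeas.swap (f := fun x u => a x * f x u) haf) μ
  have hφf : BddMeas (fun p : E × F => φ p.2 * f p.1 p.2) := (hφ.comp measurable_snd).mul hf
  set b : E → ℝ := fun x => ∫ u, φ u * f x u ∂P with hb_def
  have hb : BddMeas b := hφf.integral_right P
  have hγ := hf.gram μ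
  have hW0 : 0 ≤ W := integral_nonneg fun u => integral_nonneg fun v => sq_nonneg _
  have hA0 : 0 ≤ ∫ x, a x ^ 2 ∂μ := integral_nonneg fun x => sq_nonneg _
  have hB0 : 0 ≤ ∫ x, b x ^ 2 ∂μ := integral_nonneg fun x => sq_nonneg _
  have hQ0 : 0 ≤ ∫ u, φ u ^ 2 ∂P := integral_nonneg fun x => sq_nonneg _
  have hQ : ∫ u, φ u ^ 2 ∂P = ∫ x, a x * b x ∂μ := by
    calc ∫ u, φ u ^ 2 ∂P = ∫ u, ∫ x, φ u * (a x * f x u) ∂μ ∂P := by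
          simp only [integral_const_mul, pow_two, hφ_def]
      _ = ∫ x, ∫ u, φ u * (a x * f x u) ∂P ∂μ :=
          BddMeas.integral_swap (f := fun u x => φ u * (a x * f x u))
            ((hφ.comp measurable_fst).mul (BddMeas.swap (f := fun x u => a x * f x u) haf)) P μ
      _ = ∫ x, a x * b x ∂μ := by
          refine integral_congr_ae (Filter.Eventually.of_forall fun x => ?_)
          simp only [hb_def, ← integral_const_mul]
          refine integral_congr_ae (Filter.Eventually.of_forall fun u => ?_)
          simp only
          ring
  have hQ2 : (∫ u, φ u ^ 2 ∂P) ^ 2 ≤ (∫ x, a x ^ 2 ∂μ) * ∫ x, b x ^ 2 ∂μ := by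
    rw [hQ]
    exact sq_integral_mul_le (ha.sq.integrable μ) (hb.sq.integrable μ) ((ha.mul hb).integrable μ)
  have hB : (∫ x, b x ^ 2 ∂μ) ^ 2 ≤ (∫ u, φ u ^ 2 ∂P) ^ 2 * W := by
    have hφφ : BddMeas (fun p : F × F => φ p.1 * φ p.2) :=
      (hφ.comp measurable_fst).mul (hφ.comp measurable_snd)
    have h1 : ∫ x, b x ^ 2 ∂μ =
        ∫ p, (φ p.1 * φ p.2) * (∫ x, f x p.1 * f x p.2 ∂μ) ∂(P.prod P) := by
      rw [integral_prod _ ((hφφ.mul hγ).integrable _)]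
      exact integral_sq_integral_mul hf hφ
    have h2 : W = ∫ p, (∫ x, f x p.1 * f x p.2 ∂μ) ^ 2 ∂(P.prod P) := by
      rw [integral_prod _ (hγ.sq.integrable _)]
    have h3 : (∫ u, φ u ^ 2 ∂P) ^ 2 = ∫ p : F × F, (φ p.1 * φ p.2) ^ 2 ∂(P.prod P) := by
      rw [integral_prod _ (hφφ.sq.integrable _)]
      simp only [mul_pow, integral_const_mul, integral_mul_const]
      rw [pow_two]
    rw [h1, h2, h3]
    exact sq_integral_mul_le (hφφ.sq.integrable _) (hγ.sq.integrable _)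
      ((hφφ.mul hγ).integrable _)
  have hB' : ∫ x, b x ^ 2 ∂μ ≤ (∫ u, φ u ^ 2 ∂P) * √W := by
    refine le_of_sq_le_sq ?_ (by positivity)
    rwa [mul_pow, Real.sq_sqrt hW0]
  rcases hQ0.eq_or_lt with h0 | h0
  · rw [← h0]; positivity
  · nlinarith [mul_le_mul_of_nonneg_left hB' hA0]

/-- Centring a random function does not increase the `L²` norm of its Gram kernel. -/
lemma integral_sq_gram_centred_le {μ : Measure E} [IsFiniteMeasure μ] {P : Measure F}
    [IsProbabilityMeasure P] {z : E → F → ℝ} (hz : BddMeas (fun p : E × F => z p.1 p.2)) :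
    ∫ u, ∫ v, (∫ x, (z x u - ∫ w, z x w ∂P) * (z x v - ∫ w, z x w ∂P) ∂μ) ^ 2 ∂P ∂P ≤
      ∫ u, ∫ v, (∫ x, z x u * z x v ∂μ) ^ 2 ∂P ∂P := by
  set m : E → ℝ := fun x => ∫ w, z x w ∂P with hm_def
  have hm : BddMeas m := hz.integral_right P
  have hf : BddMeas (fun p : E × F => z p.1 p.2 - m p.1) := hz.sub (hm.comp measurable_fst)
  have hzu : ∀ u, BddMeas (fun x => z x u) := fun u =>
    hz.comp (g := fun x => (x, u)) (by fun_prop)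
  -- The Gram kernel, centred in its second variable only.
  have hmix : BddMeas (fun p : F × F => ∫ x, z x p.1 * (z x p.2 - m x) ∂μ) :=
    BddMeas.integral_right (f := fun (p : F × F) x => z x p.1 * (z x p.2 - m x))
      ((hz.comp (g := fun p : (F × F) × E => (p.2, p.1.1)) (by fun_prop)).mul
        (hf.comp (g := fun p : (F × F) × E => (p.2, p.1.2)) (by fun_prop))) μ
  have hmean : ∀ c : E → ℝ, BddMeas c → ∫ w, ∫ x, c x * z x w ∂μ ∂P = ∫ x, c x * m x ∂μ := by
    intro c hc
    rw [BddMeas.integral_swap (f := fun w x => c x * z x w)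
      (((hc.comp measurable_fst).mul hz).swap (f := fun x w => c x * z x w)) P μ]
    simp only [integral_const_mul, hm_def]
  have step1 : ∀ u, ∫ v, (∫ x, z x u * (z x v - m x) ∂μ) ^ 2 ∂P ≤
      ∫ v, (∫ x, z x u * z x v ∂μ) ^ 2 ∂P := by
    intro u
    refine le_trans (le_of_eq ?_) (integral_sq_sub_integral_le ((hz.gram μ).right (f := fun u v =>
      ∫ x, z x u * z x v ∂μ) u))
    rw [hmean _ (hzu u)]
    refine integral_congr_ae (Filter.Eventually.of_forall fun v => ?_)
    simp only [mul_sub]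
    rw [integral_sub (((hzu u).mul (hzu v)).integrable μ) (((hzu u).mul hm).integrable μ)]
  have step2 : ∀ v, ∫ u, (∫ x, (z x u - m x) * (z x v - m x) ∂μ) ^ 2 ∂P ≤
      ∫ u, (∫ x, z x u * (z x v - m x) ∂μ) ^ 2 ∂P := by
    intro v
    have hv : BddMeas (fun x => z x v - m x) := (hzu v).sub hm
    refine le_trans (le_of_eq ?_) (integral_sq_sub_integral_le (BddMeas.right
      (f := fun v u => ∫ x, z x u * (z x v - m x) ∂μ) (BddMeas.swap
        (f := fun u v => ∫ x, z x u * (z x v - m x) ∂μ) hmix) v))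
    have h1 : ∫ w, ∫ x, z x w * (z x v - m x) ∂μ ∂P = ∫ x, m x * (z x v - m x) ∂μ := by
      simp only [mul_comm _ (z _ v - m _)]
      exact hmean _ hv
    rw [h1]
    refine integral_congr_ae (Filter.Eventually.of_forall fun u => ?_)
    simp only [sub_mul (z _ u)]
    rw [integral_sub (((hzu u).mul hv).integrable μ) ((hm.mul hv).integrable μ)]
  have hγ := BddMeas.gram (f := fun x u => z x u - m x) hf μ
  calc ∫ u, ∫ v, (∫ x, (z x u - m x) * (z x v - m x) ∂μ) ^ 2 ∂P ∂P
      = ∫ v, ∫ u, (∫ x, (z x u - m x) * (z x v - m x) ∂μ) ^ 2 ∂P ∂P :=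
        BddMeas.integral_swap (f := fun u v => (∫ x, (z x u - m x) * (z x v - m x) ∂μ) ^ 2)
          hγ.sq P P
    _ ≤ ∫ v, ∫ u, (∫ x, z x u * (z x v - m x) ∂μ) ^ 2 ∂P ∂P :=
        integral_mono
          ((BddMeas.integral_right (f := fun v u =>
            (∫ x, (z x u - m x) * (z x v - m x) ∂μ) ^ 2) (BddMeas.swap (f := fun u v =>
              (∫ x, (z x u - m x) * (z x v - m x) ∂μ) ^ 2) hγ.sq) P).integrable P)
          ((BddMeas.integral_right (f := fun v u =>
            (∫ x, z x u * (z x v - m x) ∂μ) ^ 2) (BddMeas.swap (f := fun u v =>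
              (∫ x, z x u * (z x v - m x) ∂μ) ^ 2) hmix.sq) P).integrable P) step2
    _ = ∫ u, ∫ v, (∫ x, z x u * (z x v - m x) ∂μ) ^ 2 ∂P ∂P :=
        (BddMeas.integral_swap (f := fun u v => (∫ x, z x u * (z x v - m x) ∂μ) ^ 2)
          hmix.sq P P).symm
    _ ≤ ∫ u, ∫ v, (∫ x, z x u * z x v ∂μ) ^ 2 ∂P ∂P :=
        integral_mono
          ((BddMeas.integral_right (f := fun u v =>
            (∫ x, z x u * (z x v - m x) ∂μ) ^ 2) hmix.sq P).integrable P)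
          ((BddMeas.integral_right (f := fun u v =>
            (∫ x, z x u * z x v ∂μ) ^ 2) (hz.gram μ).sq P).integrable P) step1

variable {ι : Type*}

/-- The split-sample quadratic statistic `∫ (ẑ - q)(ẑ' - q) dμ`, where `ẑ` and `ẑ'` are the
empirical means of `z(x, X_i)` over the two batches `S` and `S'`. -/
def splitStat (μ : Measure E) (k : ℕ) (S S' : Finset ι) (z : E → F → ℝ) (q : E → ℝ)
    (X : ι → F) : ℝ :=
  ∫ x, ((1 / (k : ℝ)) * ∑ i ∈ S, z x (X i) - q x) * ((1 / (k : ℝ)) * ∑ i ∈ S', z x (X i) - q x) ∂μ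

/-- Hoeffding's decomposition of the split-sample statistic. -/
lemma splitStat_sub_eq {μ : Measure E} [IsFiniteMeasure μ] {k : ℕ} (hk : 0 < k)
    {S S' : Finset ι} (hSc : S.card = k) (hSc' : S'.card = k) {z : E → F → ℝ}
    (hz : BddMeas (fun p : E × F => z p.1 p.2)) {q m : E → ℝ} (hq : BddMeas q) (hm : BddMeas m)
    (X : ι → F) :
    splitStat μ k S S' z q X - ∫ x, (m x - q x) ^ 2 ∂μ =
      (1 / (k : ℝ)) * (∑ i ∈ S, ∫ x, (m x - q x) * (z x (X i) - m x) ∂μ) +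
      (1 / (k : ℝ)) * (∑ i ∈ S', ∫ x, (m x - q x) * (z x (X i) - m x) ∂μ) +
      (1 / (k : ℝ)) ^ 2 * (∑ e ∈ S ×ˢ S',
        ∫ x, (z x (X e.1) - m x) * (z x (X e.2) - m x) ∂μ) := by
  have hk' : (k : ℝ) ≠ 0 := by positivity
  have ha : BddMeas (fun x => m x - q x) := hm.sub hq
  have hf : ∀ u, BddMeas (fun x => z x u - m x) := fun u =>
    (hz.comp (g := fun x => (x, u)) (by fun_prop)).sub hm
  have key : ∀ S : Finset ι, S.card = k → ∀ x, (1 / (k : ℝ)) * ∑ i ∈ S, z x (X i) - q x =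
      (1 / (k : ℝ)) * ∑ i ∈ S, (z x (X i) - m x) + (m x - q x) := by
    intro S hS x
    rw [Finset.sum_sub_distrib, Finset.sum_const, hS, nsmul_eq_mul]
    field_simp
    ring
  have expand : ∀ x, ((1 / (k : ℝ)) * ∑ i ∈ S, z x (X i) - q x) *
      ((1 / (k : ℝ)) * ∑ i ∈ S', z x (X i) - q x) =
      (m x - q x) ^ 2 + ((1 / (k : ℝ)) * (∑ i ∈ S, (m x - q x) * (z x (X i) - m x)) +
      (1 / (k : ℝ)) * (∑ i ∈ S', (m x - q x) * (z x (X i) - m x)) +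
      (1 / (k : ℝ)) ^ 2 * (∑ e ∈ S ×ˢ S', (z x (X e.1) - m x) * (z x (X e.2) - m x))) := by
    intro x
    rw [key S hSc, key S' hSc', Finset.sum_product, ← Finset.mul_sum, ← Finset.mul_sum]
    simp only [← Finset.mul_sum, ← Finset.sum_mul]
    ring
  have b1 : ∀ S : Finset ι, BddMeas (fun x => ∑ i ∈ S, (m x - q x) * (z x (X i) - m x)) :=
    fun S => BddMeas.sum S fun i _ => ha.mul (hf _)
  have b2 : BddMeas (fun x => ∑ e ∈ S ×ˢ S', (z x (X e.1) - m x) * (z x (X e.2) - m x)) :=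
    BddMeas.sum _ fun e _ => (hf _).mul (hf _)
  have i1 := fun S => ((BddMeas.const (1 / (k : ℝ))).mul (b1 S)).integrable μ
  have i2 := ((BddMeas.const ((1 / (k : ℝ)) ^ 2)).mul b2).integrable μ
  unfold splitStat
  simp only [expand]
  rw [integral_add (ha.sq.integrable μ) (by exact ((i1 S).add (i1 S')).add i2),
    integral_add (by exact (i1 S).add (i1 S')) i2, integral_add (i1 S) (i1 S'),
    integral_const_mul, integral_const_mul, integral_const_mul,
    integral_finsetSum _ fun i _ => (ha.mul (hf _)).integrable μ,
    integral_finsetSum _ fun i _ => (ha.mul (hf _)).integrable μ,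
    integral_finsetSum _ fun i _ => ((hf _).mul (hf _)).integrable μ]
  ring

lemma BddMeas.splitStat {μ : Measure E} [IsFiniteMeasure μ] (k : ℕ) (S S' : Finset ι)
    {z : E → F → ℝ} (hz : BddMeas (fun p : E × F => z p.1 p.2)) {q : E → ℝ} (hq : BddMeas q) :
    BddMeas (splitStat μ k S S' z q) := by
  have h : ∀ S : Finset ι, BddMeas (fun p : (ι → F) × E =>
      (1 / (k : ℝ)) * ∑ i ∈ S, z p.2 (p.1 i) - q p.2) := fun S =>
    ((BddMeas.const _).mul (BddMeas.sum S fun i _ =>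
      hz.comp (g := fun p : (ι → F) × E => (p.2, p.1 i)) (by fun_prop))).sub
      (hq.comp measurable_snd)
  exact BddMeas.integral_right (f := fun (X : ι → F) x =>
    ((1 / (k : ℝ)) * ∑ i ∈ S, z x (X i) - q x) *
      ((1 / (k : ℝ)) * ∑ i ∈ S', z x (X i) - q x)) ((h S).mul (h S')) μ

/-- The mean square deviation of the split-sample statistic from `∫ (m - q)² dμ`, where `m` is the
mean of `z`, is controlled by that integral and by the `L²` norm of the Gram kernel of `z`. -/
lemma integral_sq_splitStat_sub_le [Fintype ι] [DecidableEq ι] {μ : Measure E} [IsFiniteMeasure μ]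
    {P : Measure F} [IsProbabilityMeasure P] {k : ℕ} (hk : 0 < k) {S S' : Finset ι}
    (hS : Disjoint S S') (hSc : S.card = k) (hSc' : S'.card = k) {z : E → F → ℝ}
    (hz : BddMeas (fun p : E × F => z p.1 p.2)) {q : E → ℝ} (hq : BddMeas q) :
    ∫ X, (splitStat μ k S S' z q X - ∫ x, ((∫ u, z x u ∂P) - q x) ^ 2 ∂μ) ^ 2
        ∂(Measure.pi fun _ : ι => P) ≤
      6 * ((∫ x, ((∫ u, z x u ∂P) - q x) ^ 2 ∂μ) *
        √((∫ u, ∫ v, (∫ x, z x u * z x v ∂μ) ^ 2 ∂P ∂P) / k ^ 2)) +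
      3 * ((∫ u, ∫ v, (∫ x, z x u * z x v ∂μ) ^ 2 ∂P ∂P) / k ^ 2) := by
  set m : E → ℝ := fun x => ∫ u, z x u ∂P with hm_def
  have hm : BddMeas m := hz.integral_right P
  set A := ∫ x, (m x - q x) ^ 2 ∂μ with hA
  set W := ∫ u, ∫ v, (∫ x, z x u * z x v ∂μ) ^ 2 ∂P ∂P with hW
  have ha : BddMeas (fun x => m x - q x) := hm.sub hq
  have hf : BddMeas (fun p : E × F => z p.1 p.2 - m p.1) := hz.sub (hm.comp measurable_fst)
  have hf0 : ∀ x, ∫ u, (z x u - m x) ∂P = 0 := fun x => by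
    rw [integral_sub ((hz.right x).integrable P) (integrable_const _)]
    simp [hm_def]
  set φ : F → ℝ := fun u => ∫ x, (m x - q x) * (z x u - m x) ∂μ with hφ_def
  set γ : F → F → ℝ := fun u v => ∫ x, (z x u - m x) * (z x v - m x) ∂μ with hγ_def
  have haf : BddMeas (fun p : E × F => (m p.1 - q p.1) * (z p.1 p.2 - m p.1)) :=
    (ha.comp measurable_fst).mul hf
  have hφ : BddMeas φ :=
    BddMeas.integral_right (f := fun u x => (m x - q x) * (z x u - m x))
      (BddMeas.swap (f := fun x u => (m x - q x) * (z x u - m x)) haf) μ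
  have hγ : BddMeas (fun p : F × F => γ p.1 p.2) := BddMeas.gram (f := fun x u => z x u - m x) hf μ
  have hfu : ∀ u, BddMeas (fun x => z x u - m x) := fun u =>
    hf.comp (g := fun x => (x, u)) (by fun_prop)
  have hmean : ∀ c : E → ℝ, BddMeas c → ∫ u, ∫ x, c x * (z x u - m x) ∂μ ∂P = 0 := by
    intro c hc
    rw [BddMeas.integral_swap (f := fun u x => c x * (z x u - m x))
      (((hc.comp measurable_fst).mul hf).swap (f := fun x u => c x * (z x u - m x))) P μ]
    simp only [integral_const_mul, hf0, mul_zero, integral_zero]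
  have hφ0 : ∫ u, φ u ∂P = 0 := hmean _ ha
  have hγ1 : ∀ u, ∫ v, γ u v ∂P = 0 := fun u => hmean _ (hfu u)
  have hγ2 : ∀ v, ∫ u, γ u v ∂P = 0 := fun v => by
    rw [← hγ1 v]
    simp only [hγ_def, mul_comm]
  have hk' : (0 : ℝ) < k := by exact_mod_cast hk
  have hA0 : 0 ≤ A := integral_nonneg fun x => sq_nonneg _
  have hγW : ∫ u, ∫ v, γ u v ^ 2 ∂P ∂P ≤ W := integral_sq_gram_centred_le hz
  have hφW : ∫ u, φ u ^ 2 ∂P ≤ A * √W :=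
    (integral_sq_inner_le (f := fun x u => z x u - m x) hf ha).trans
      (mul_le_mul_of_nonneg_left (Real.sqrt_le_sqrt hγW) hA0)
  have e1 := integral_sum_eval_sq P S hφ hφ0
  have e2 := integral_sum_eval_sq P S' hφ hφ0
  have e3 := integral_sum_eval_pair_sq P hS hγ hγ1 hγ2
  rw [hSc] at e1 e3
  rw [hSc'] at e2 e3
  have bφ : ∀ S : Finset ι, BddMeas (fun X : ι → F => (∑ i ∈ S, φ (X i)) ^ 2) := fun S =>
    (BddMeas.sum S fun i _ => hφ.comp (measurable_pi_apply i)).sq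
  have bγ : BddMeas (fun X : ι → F => (∑ e ∈ S ×ˢ S', γ (X e.1) (X e.2)) ^ 2) :=
    (BddMeas.sum _ fun e _ =>
      hγ.comp (g := fun X : ι → F => (X e.1, X e.2)) (by fun_prop)).sq
  have iφ := fun S => (bφ S).integrable (Measure.pi fun _ : ι => P)
  have iγ := bγ.integrable (Measure.pi fun _ : ι => P)
  have hsqrt : √(W / k ^ 2) = √W / k := by
    rw [Real.sqrt_div' _ (by positivity), Real.sqrt_sq hk'.le]
  calc ∫ X, (splitStat μ k S S' z q X - A) ^ 2 ∂(Measure.pi fun _ : ι => P)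
      ≤ ∫ X, (3 * (1 / (k : ℝ)) ^ 2 * (∑ i ∈ S, φ (X i)) ^ 2 +
          3 * (1 / (k : ℝ)) ^ 2 * (∑ i ∈ S', φ (X i)) ^ 2 +
          3 * (1 / (k : ℝ)) ^ 4 * (∑ e ∈ S ×ˢ S', γ (X e.1) (X e.2)) ^ 2)
          ∂(Measure.pi fun _ : ι => P) := by
        refine integral_mono (((BddMeas.splitStat k S S' hz hq).sub (BddMeas.const A)).sq.integrable
          _) (by exact (((iφ S).const_mul _).add ((iφ S').const_mul _)).add (iγ.const_mul _))
          fun X => ?_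
        simp only [hA]
        rw [splitStat_sub_eq hk hSc hSc' hz hq hm X]
        set s1 := ∑ i ∈ S, φ (X i)
        set s2 := ∑ i ∈ S', φ (X i)
        set s3 := ∑ e ∈ S ×ˢ S', γ (X e.1) (X e.2)
        have : ∀ p q r : ℝ, (p + q + r) ^ 2 ≤ 3 * (p ^ 2 + q ^ 2 + r ^ 2) := fun p q r => by
          nlinarith [sq_nonneg (p - q), sq_nonneg (p - r), sq_nonneg (q - r)]
        refine (this _ _ _).trans (le_of_eq ?_)
        ring
    _ = 3 * (1 / (k : ℝ)) ^ 2 * (k * ∫ u, φ u ^ 2 ∂P) +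
          3 * (1 / (k : ℝ)) ^ 2 * (k * ∫ u, φ u ^ 2 ∂P) +
          3 * (1 / (k : ℝ)) ^ 4 * (k * k * ∫ u, ∫ v, γ u v ^ 2 ∂P ∂P) := by
        rw [integral_add (by exact ((iφ S).const_mul _).add ((iφ S').const_mul _))
          (iγ.const_mul _), integral_add ((iφ S).const_mul _) ((iφ S').const_mul _),
          integral_const_mul, integral_const_mul, integral_const_mul, e1, e2, e3]
    _ = 6 * ((∫ u, φ u ^ 2 ∂P) / k) + 3 * ((∫ u, ∫ v, γ u v ^ 2 ∂P ∂P) / k ^ 2) := by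
        field_simp
        ring
    _ ≤ 6 * (A * √(W / k ^ 2)) + 3 * (W / k ^ 2) := by
        rw [hsqrt, ← mul_div_assoc A]
        gcongr

end SplitSample

/-! ### The Gram kernel of the localised kernel functions -/

/-- The volume of the unit ball of `ℝ^d`. -/
def ballVol (d : ℕ) : ℝ := volume.real (Metric.ball (0 : Space d) 1)

lemma ballVol_nonneg (d : ℕ) : 0 ≤ ballVol d := measureReal_nonneg

lemma volume_real_closedBall_le {d : ℕ} (x : Space d) {r : ℝ} (hr : 0 ≤ r) :
    volume.real (Metric.closedBall x r) = r ^ d * ballVol d := by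
  rw [Measure.addHaar_real_closedBall _ _ hr]
  simp [ballVol]

section Kernel

variable {d : ℕ} {K : Space d → ℝ} {M : ℝ}

lemma abs_scaledKernel_le (hM : ∀ x, |K x| ≤ M) {h : ℝ} (hh : 0 < h) (y : Space d) :
    |scaledKernel K h y| ≤ M / h ^ d := by
  rw [scaledKernel, abs_mul, abs_of_pos (by positivity : 0 < 1 / h ^ d), one_div_mul_eq_div]
  gcongr
  exact hM _

lemma scaledKernel_eq_zero (hs : ∀ x, 1 / 2 < ‖x‖ → K x = 0) {h : ℝ} (hh : 0 < h) {y : Space d}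
    (hy : h / 2 < ‖y‖) : scaledKernel K h y = 0 := by
  rw [scaledKernel, hs, mul_zero]
  rw [norm_smul, norm_inv, Real.norm_of_nonneg hh.le, inv_mul_eq_div, lt_div_iff₀ hh]
  linarith

/-- The kernel average of `p` at `x` is controlled by a bound for `p` near `x`. -/
lemma integral_abs_scaledKernel_mul_le (hM : ∀ x, |K x| ≤ M) (hs : ∀ x, 1 / 2 < ‖x‖ → K x = 0)
    {h : ℝ} (hh : 0 < h) {p : Space d → ℝ} (hp : ∀ u, 0 ≤ p u) (x : Space d) {b : ℝ}
    (hb0 : 0 ≤ b) (hb : ∀ u, ‖x - u‖ ≤ h / 2 → p u ≤ b) :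
    ∫ u, |scaledKernel K h (x - u)| * p u ≤ M * ballVol d * b := by
  have hM0 : 0 ≤ M := (abs_nonneg _).trans (hM 0)
  have h1 : ∀ u, |scaledKernel K h (x - u)| * p u ≤
      (Metric.closedBall x (h / 2)).indicator (fun _ => M / h ^ d * b) u := by
    intro u
    by_cases hu : ‖x - u‖ ≤ h / 2
    · rw [Set.indicator_of_mem (by rwa [Metric.mem_closedBall, dist_comm, dist_eq_norm])]
      exact mul_le_mul (abs_scaledKernel_le hM hh _) (hb u hu) (hp u) (by positivity)
    · rw [scaledKernel_eq_zero hs hh (not_le.1 hu), abs_zero, zero_mul]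
      exact Set.indicator_nonneg (fun _ _ => by positivity) _
  calc ∫ u, |scaledKernel K h (x - u)| * p u
      ≤ ∫ u, (Metric.closedBall x (h / 2)).indicator (fun _ => M / h ^ d * b) u := by
        refine integral_mono_of_nonneg (Filter.Eventually.of_forall fun u =>
          mul_nonneg (abs_nonneg _) (hp u)) ?_ (Filter.Eventually.of_forall h1)
        exact (integrable_indicator_iff measurableSet_closedBall).2
          (integrableOn_const (measure_closedBall_lt_top).ne)
    _ = (h / 2) ^ d * ballVol d * (M / h ^ d * b) := by
        rw [integral_indicator measurableSet_closedBall, setIntegral_const,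
          volume_real_closedBall_le _ (by positivity), smul_eq_mul]
    _ = (1 / 2) ^ d * (M * ballVol d * b) := by
        rw [div_pow, div_pow, one_pow]
        field_simp
    _ ≤ 1 * (M * ballVol d * b) := by
        have := ballVol_nonneg d
        gcongr
        exact pow_le_one₀ (by norm_num) (by norm_num)
    _ = _ := one_mul _

end Kernel

/-- The local situation on the bulk `B`: a bounded compactly supported kernel `K`, a weight `ω`
and a variable bandwidth `h = κ p₀^e`, such that `p₀` is bounded away from `0` and `∞` on `B` and
varies by at most a constant factor on the balls of radius `h(x) / 2` around points `x ∈ B`. -/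
structure LocalSetup {d : ℕ} (K p₀ h ω : Space d → ℝ) (B : Set (Space d)) (M κ e : ℝ) : Prop where
  meas_K : Measurable K
  bound_K : ∀ x, |K x| ≤ M
  supp_K : ∀ x, 1 / 2 < ‖x‖ → K x = 0
  meas_p₀ : Measurable p₀
  meas_B : MeasurableSet B
  vol_B : volume B ≠ ∞
  κ_pos : 0 < κ
  e_nonneg : 0 ≤ e
  h_eq : ∀ x, h x = κ * p₀ x ^ e
  meas_ω : Measurable ω
  ω_nonneg : ∀ x, 0 ≤ ω x
  ω_bdd : ∃ C, ∀ x ∈ B, ω x ≤ C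
  p₀_lower : ∃ v, 0 < v ∧ ∀ x ∈ B, v ≤ p₀ x
  p₀_upper : ∃ V, ∀ x ∈ B, p₀ x ≤ V
  comparable : ∀ x ∈ B, ∀ u, ‖x - u‖ ≤ h x / 2 → p₀ x ≤ 4 * p₀ u ∧ p₀ u ≤ 2 * p₀ x

/-- The localised kernel functions `z(x, u) = 1_B(x) √ω(x) K_{h(x)}(x - u)`. -/
def locKernel {d : ℕ} (K h ω : Space d → ℝ) (B : Set (Space d)) (x u : Space d) : ℝ :=
  B.indicator (fun x => √(ω x)) x * B.indicator (fun x => scaledKernel K (h x) (x - u)) x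

namespace LocalSetup

variable {d : ℕ} {K p₀ h ω : Space d → ℝ} {B : Set (Space d)} {M κ e : ℝ}

lemma meas_h (S : LocalSetup K p₀ h ω B M κ e) : Measurable h := by
  have : h = fun x => κ * p₀ x ^ e := funext S.h_eq
  rw [this]
  exact (S.meas_p₀.pow_const e).const_mul κ

lemma p₀_pos (S : LocalSetup K p₀ h ω B M κ e) {x : Space d} (hx : x ∈ B) : 0 < p₀ x := by
  obtain ⟨v, hv, hvB⟩ := S.p₀_lower
  exact hv.trans_le (hvB x hx)

lemma h_pos (S : LocalSetup K p₀ h ω B M κ e) {x : Space d} (hx : x ∈ B) : 0 < h x := by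
  rw [S.h_eq]
  exact mul_pos S.κ_pos (Real.rpow_pos_of_pos (S.p₀_pos hx) _)

lemma h_lower (S : LocalSetup K p₀ h ω B M κ e) : ∃ b, 0 < b ∧ ∀ x ∈ B, b ≤ h x := by
  obtain ⟨v, hv, hvB⟩ := S.p₀_lower
  refine ⟨κ * v ^ e, mul_pos S.κ_pos (Real.rpow_pos_of_pos hv _), fun x hx => ?_⟩
  rw [S.h_eq]
  exact mul_le_mul_of_nonneg_left (Real.rpow_le_rpow hv.le (hvB x hx) S.e_nonneg) S.κ_pos.le

lemma h_upper (S : LocalSetup K p₀ h ω B M κ e) : ∃ b, ∀ x ∈ B, h x ≤ b := by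
  obtain ⟨V, hV⟩ := S.p₀_upper
  refine ⟨κ * V ^ e, fun x hx => ?_⟩
  rw [S.h_eq]
  exact mul_le_mul_of_nonneg_left
    (Real.rpow_le_rpow (S.p₀_pos hx).le (hV x hx) S.e_nonneg) S.κ_pos.le

lemma M_nonneg (S : LocalSetup K p₀ h ω B M κ e) : 0 ≤ M := (abs_nonneg _).trans (S.bound_K 0)

lemma isFiniteMeasure (S : LocalSetup K p₀ h ω B M κ e) :
    IsFiniteMeasure (volume.restrict B) :=
  ⟨by simpa using S.vol_B.lt_top⟩

lemma bddMeas_indicator (S : LocalSetup K p₀ h ω B M κ e) {c : Space d → ℝ} (hc : Measurable c)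
    (hcb : ∃ C, ∀ x ∈ B, |c x| ≤ C) : BddMeas (B.indicator c) := by
  obtain ⟨C, hC⟩ := hcb
  refine ⟨hc.indicator S.meas_B, |C|, fun x => ?_⟩
  by_cases hx : x ∈ B
  · rw [Set.indicator_of_mem hx]; exact (hC x hx).trans (le_abs_self C)
  · rw [Set.indicator_of_notMem hx]; simp

/-- The kernel functions `(x, u) ↦ 1_B(x) K_{h(x)}(x - u)`. -/
lemma bddMeas_kernel (S : LocalSetup K p₀ h ω B M κ e) :
    BddMeas (fun q : Space d × Space d =>
      B.indicator (fun x => scaledKernel K (h x) (x - q.2)) q.1) := by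
  obtain ⟨b, hb, hbB⟩ := S.h_lower
  have hM := S.M_nonneg
  constructor
  · have h1 : Measurable (fun q : Space d × Space d => scaledKernel K (h q.1) (q.1 - q.2)) := by
      unfold scaledKernel
      have hh : Measurable fun q : Space d × Space d => h q.1 := S.meas_h.comp measurable_fst
      exact (measurable_const.div (hh.pow_const d)).mul
        (S.meas_K.comp (hh.inv.smul (measurable_fst.sub measurable_snd)))
    exact h1.indicator (measurable_fst S.meas_B)
  · refine ⟨M / b ^ d, fun q => ?_⟩
    simp only
    by_cases hx : q.1 ∈ B
    · rw [Set.indicator_of_mem hx]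
      refine (abs_scaledKernel_le S.bound_K (S.h_pos hx) _).trans ?_
      gcongr
      exact hbB _ hx
    · rw [Set.indicator_of_notMem hx]; simp; positivity

lemma bddMeas_sqrt_weight (S : LocalSetup K p₀ h ω B M κ e) :
    BddMeas (B.indicator (fun x => √(ω x))) := by
  obtain ⟨C, hC⟩ := S.ω_bdd
  refine S.bddMeas_indicator S.meas_ω.sqrt ⟨√C, fun x hx => ?_⟩
  rw [abs_of_nonneg (Real.sqrt_nonneg _)]
  exact Real.sqrt_le_sqrt (hC x hx)

lemma bddMeas_locKernel (S : LocalSetup K p₀ h ω B M κ e) :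
    BddMeas (fun q : Space d × Space d => locKernel K h ω B q.1 q.2) :=
  (S.bddMeas_sqrt_weight.comp measurable_fst).mul S.bddMeas_kernel

/-- The function `x ↦ h(x)^d |K_{h(x)}(x - u)| |K_{h(x)}(x - v)|` has a bounded integral over `B`,
because the bandwidths of all the points `x` that can see `u` are comparable. -/
lemma integral_pow_mul_kernel_le (S : LocalSetup K p₀ h ω B M κ e) (u v : Space d) :
    ∫ x in B, h x ^ d * (|scaledKernel K (h x) (x - u)| * |scaledKernel K (h x) (x - v)|) ≤
      M ^ 2 * ((8 : ℝ) ^ e) ^ d * ballVol d := by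
  have hM := S.M_nonneg
  have hV := ballVol_nonneg d
  by_cases hu : 0 < p₀ u
  swap
  · have : ∀ x ∈ B, h x ^ d * (|scaledKernel K (h x) (x - u)| * |scaledKernel K (h x) (x - v)|)
        = 0 := by
      intro x hx
      rw [scaledKernel_eq_zero S.supp_K (S.h_pos hx) (y := x - u)]
      · simp
      · by_contra hxu
        have := (S.comparable x hx u (not_lt.1 hxu)).1
        have := S.p₀_pos hx
        linarith
    rw [setIntegral_congr_fun S.meas_B this, integral_zero]
    positivity
  set H : ℝ := κ * p₀ u ^ e with hH
  have hH0 : 0 < H := mul_pos S.κ_pos (Real.rpow_pos_of_pos hu _)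
  have h2e : (0 : ℝ) < 2 ^ e := by positivity
  have h4e : (0 : ℝ) < 4 ^ e := by positivity
  have hpt : ∀ x ∈ B, h x ^ d *
      (|scaledKernel K (h x) (x - u)| * |scaledKernel K (h x) (x - v)|) ≤
      (Metric.closedBall u (4 ^ e * H / 2)).indicator (fun _ => M ^ 2 * (2 ^ e / H) ^ d) x := by
    intro x hx
    have hh := S.h_pos hx
    by_cases hxu : ‖x - u‖ ≤ h x / 2
    · obtain ⟨hc1, hc2⟩ := S.comparable x hx u hxu
      have hup : h x ≤ 4 ^ e * H := by
        rw [S.h_eq, hH, mul_left_comm, ← Real.mul_rpow (by norm_num) hu.le]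
        exact mul_le_mul_of_nonneg_left
          (Real.rpow_le_rpow (S.p₀_pos hx).le hc1 S.e_nonneg) S.κ_pos.le
      have hlo : H ≤ 2 ^ e * h x := by
        rw [S.h_eq, hH, mul_left_comm, ← Real.mul_rpow (by norm_num) (S.p₀_pos hx).le]
        exact mul_le_mul_of_nonneg_left (Real.rpow_le_rpow hu.le hc2 S.e_nonneg) S.κ_pos.le
      rw [Set.indicator_of_mem (by rw [Metric.mem_closedBall, dist_eq_norm]; linarith)]
      calc h x ^ d * (|scaledKernel K (h x) (x - u)| * |scaledKernel K (h x) (x - v)|)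
          ≤ h x ^ d * ((M / h x ^ d) * (M / h x ^ d)) := by
            gcongr
            · exact abs_scaledKernel_le S.bound_K hh _
            · exact abs_scaledKernel_le S.bound_K hh _
        _ = M ^ 2 * (1 / h x) ^ d := by
            rw [div_pow, one_pow]; field_simp
        _ ≤ M ^ 2 * (2 ^ e / H) ^ d := by
            refine mul_le_mul_of_nonneg_left (pow_le_pow_left₀ (by positivity) ?_ d) (sq_nonneg M)
            rw [div_le_div_iff₀ hh hH0]
            linarith
    · rw [scaledKernel_eq_zero S.supp_K hh (not_le.1 hxu)]
      simp only [abs_zero, zero_mul, mul_zero]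
      exact Set.indicator_nonneg (fun _ _ => by positivity) _
  have hint : Integrable
      ((Metric.closedBall u (4 ^ e * H / 2)).indicator (fun _ => M ^ 2 * (2 ^ e / H) ^ d)) :=
    (integrable_indicator_iff measurableSet_closedBall).2
      (integrableOn_const (measure_closedBall_lt_top).ne)
  calc ∫ x in B, h x ^ d * (|scaledKernel K (h x) (x - u)| * |scaledKernel K (h x) (x - v)|)
      ≤ ∫ x in B, (Metric.closedBall u (4 ^ e * H / 2)).indicator
          (fun _ => M ^ 2 * (2 ^ e / H) ^ d) x := by
        refine integral_mono_of_nonneg ?_ hint.integrableOn ?_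
        · filter_upwards [ae_restrict_mem S.meas_B] with x hx
          have := S.h_pos hx
          simp only [Pi.zero_apply]
          positivity
        · filter_upwards [ae_restrict_mem S.meas_B] with x hx using hpt x hx
    _ ≤ ∫ x, (Metric.closedBall u (4 ^ e * H / 2)).indicator
          (fun _ => M ^ 2 * (2 ^ e / H) ^ d) x :=
        setIntegral_le_integral hint (Filter.Eventually.of_forall fun x =>
          Set.indicator_nonneg (fun _ _ => by positivity) _)
    _ = (4 ^ e * H / 2) ^ d * ballVol d * (M ^ 2 * (2 ^ e / H) ^ d) := by
        rw [integral_indicator measurableSet_closedBall, setIntegral_const,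
          volume_real_closedBall_le _ (by positivity), smul_eq_mul]
    _ = M ^ 2 * ((4 ^ e * H / 2) * (2 ^ e / H)) ^ d * ballVol d := by
        rw [mul_pow]; ring
    _ = M ^ 2 * ((8 : ℝ) ^ e / 2) ^ d * ballVol d := by
        have : (8 : ℝ) ^ e = 4 ^ e * 2 ^ e := by
          rw [← Real.mul_rpow (by norm_num) (by norm_num)]; norm_num
        rw [this]
        congr 3
        field_simp
    _ ≤ _ := by
        gcongr
        have : (0 : ℝ) < 8 ^ e := by positivity
        linarith

/-- The `L²` norm of the Gram kernel of the localised kernel functions, for observations with a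
density `p` that is controlled near each `x ∈ B` by `b(x)`. -/
lemma integral_sq_gram_locKernel_le (S : LocalSetup K p₀ h ω B M κ e) {p : Space d → ℝ}
    (hpm : Measurable p) (hp : ∀ u, 0 ≤ p u)
    [IsProbabilityMeasure (volume.withDensity fun x => ENNReal.ofReal (p x))]
    {b : Space d → ℝ} (hbm : Measurable b) (hb0 : ∀ x ∈ B, 0 ≤ b x) (hbB : ∃ C, ∀ x ∈ B, b x ≤ C)
    (hb : ∀ x ∈ B, ∀ u, ‖x - u‖ ≤ h x / 2 → p u ≤ b x) :
    ∫ u, ∫ v, (∫ x in B, locKernel K h ω B x u * locKernel K h ω B x v) ^ 2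
        ∂(volume.withDensity fun x => ENNReal.ofReal (p x))
        ∂(volume.withDensity fun x => ENNReal.ofReal (p x)) ≤
      (M ^ 2 * ((8 : ℝ) ^ e) ^ d * ballVol d * (M * ballVol d) ^ 2) *
        ∫ x in B, ω x ^ 2 / h x ^ d * b x ^ 2 := by
  have := S.isFiniteMeasure
  set P := volume.withDensity fun x => ENNReal.ofReal (p x) with hP
  have hM := S.M_nonneg
  have hV := ballVol_nonneg d
  obtain ⟨cω, hcω⟩ := S.ω_bdd
  obtain ⟨hl, hl0, hlB⟩ := S.h_lower
  obtain ⟨hu, huB⟩ := S.h_upper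
  obtain ⟨cb, hcb⟩ := hbB
  -- Everything below is cut off outside `B`, which makes it bounded.
  set k : Space d → Space d → ℝ := fun x u =>
    |B.indicator (fun x => scaledKernel K (h x) (x - u)) x| with hk
  have hkm : BddMeas (fun q : Space d × Space d => k q.1 q.2) :=
    ⟨S.bddMeas_kernel.1.norm, S.bddMeas_kernel.2.imp fun C hC q => by
      simpa only [hk, abs_abs] using hC q⟩
  have hk0 : ∀ x u, 0 ≤ k x u := fun x u => abs_nonneg _
  set r : Space d → ℝ := B.indicator (fun x => ω x / √(h x ^ d)) with hr
  have hrm : BddMeas r := by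
    refine S.bddMeas_indicator (S.meas_ω.div (S.meas_h.pow_const d).sqrt)
      ⟨cω / √(hl ^ d), fun x hx => ?_⟩
    have := S.h_pos hx
    have := S.ω_nonneg x
    rw [abs_of_nonneg (by positivity)]
    gcongr
    · exact this.trans (hcω x hx)
    · exact hcω x hx
    · exact hlB x hx
  set s : Space d → ℝ := B.indicator (fun x => √(h x ^ d)) with hs
  have hsm : BddMeas s := by
    refine S.bddMeas_indicator (S.meas_h.pow_const d).sqrt ⟨√(hu ^ d), fun x hx => ?_⟩
    rw [abs_of_nonneg (Real.sqrt_nonneg _)]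
    have := S.h_pos hx
    gcongr
    exact huB x hx
  have hr0 : ∀ x, 0 ≤ r x := fun x => Set.indicator_nonneg (fun x _ =>
    div_nonneg (S.ω_nonneg x) (Real.sqrt_nonneg _)) x
  have hku : ∀ u, BddMeas (fun x => k x u) := fun u =>
    hkm.comp (g := fun x => (x, u)) (by fun_prop)
  have hkk0 : ∀ x u v, 0 ≤ k x u * k x v := fun x u v => mul_nonneg (hk0 x u) (hk0 x v)
  have hsq : ∀ u v, BddMeas (fun x => √(k x u * k x v)) := by
    intro u v
    obtain ⟨hm, C, hC⟩ := (hku u).mul (hku v)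
    refine ⟨hm.sqrt, √C, fun x => ?_⟩
    rw [abs_of_nonneg (Real.sqrt_nonneg _)]
    exact Real.sqrt_le_sqrt ((le_abs_self _).trans (hC x))
  set C₁ := M ^ 2 * ((8 : ℝ) ^ e) ^ d * ballVol d with hC₁
  have hrk : BddMeas (fun q : Space d × Space d => r q.1 * k q.1 q.2) :=
    (hrm.comp measurable_fst).mul hkm
  have hpt : ∀ u v, (∫ x in B, locKernel K h ω B x u * locKernel K h ω B x v) ^ 2 ≤
      C₁ * ∫ x in B, (r x * k x u) * (r x * k x v) := by
    intro u v
    have habs : |∫ x in B, locKernel K h ω B x u * locKernel K h ω B x v| ≤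
        ∫ x in B, (r x * √(k x u * k x v)) * (s x * √(k x u * k x v)) := by
      refine abs_integral_le_integral_abs.trans (le_of_eq ?_)
      refine setIntegral_congr_fun S.meas_B fun x hx => ?_
      have hh := S.h_pos hx
      simp only [locKernel, hr, hs, hk, Set.indicator_of_mem hx, abs_mul]
      rw [abs_of_nonneg (Real.sqrt_nonneg _), mul_mul_mul_comm,
        mul_mul_mul_comm (ω x / √(h x ^ d)), Real.mul_self_sqrt (S.ω_nonneg x),
        Real.mul_self_sqrt (by positivity), div_mul_cancel₀ _ (by positivity)]
    have hcs := sq_integral_mul_le (μ := volume.restrict B)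
      ((hrm.mul (hsq u v)).sq.integrable _) ((hsm.mul (hsq u v)).sq.integrable _)
      (((hrm.mul (hsq u v)).mul (hsm.mul (hsq u v))).integrable _)
    have h1 : ∫ x in B, (r x * √(k x u * k x v)) ^ 2 =
        ∫ x in B, (r x * k x u) * (r x * k x v) := by
      refine integral_congr_ae (Filter.Eventually.of_forall fun x => ?_)
      simp only [mul_pow, Real.sq_sqrt (hkk0 x u v)]
      ring
    have h2 : ∫ x in B, (s x * √(k x u * k x v)) ^ 2 ≤ C₁ := by
      refine le_trans (le_of_eq ?_) (S.integral_pow_mul_kernel_le u v)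
      refine setIntegral_congr_fun S.meas_B fun x hx => ?_
      have hh := S.h_pos hx
      simp only [mul_pow, Real.sq_sqrt (hkk0 x u v)]
      simp only [hs, hk, Set.indicator_of_mem hx]
      rw [Real.sq_sqrt (by positivity)]
    have h3 : 0 ≤ ∫ x in B, (r x * k x u) * (r x * k x v) :=
      integral_nonneg fun x => mul_nonneg (mul_nonneg (hr0 x) (hk0 x u))
        (mul_nonneg (hr0 x) (hk0 x v))
    calc (∫ x in B, locKernel K h ω B x u * locKernel K h ω B x v) ^ 2
        ≤ (∫ x in B, (r x * √(k x u * k x v)) * (s x * √(k x u * k x v))) ^ 2 :=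
          sq_le_sq' (neg_le_of_abs_le habs) ((le_abs_self _).trans habs)
      _ ≤ _ := hcs
      _ ≤ (∫ x in B, (r x * k x u) * (r x * k x v)) * C₁ := by
          rw [h1]; exact mul_le_mul_of_nonneg_left h2 h3
      _ = _ := mul_comm _ _
  have hkP : ∀ x ∈ B, ∫ u, r x * k x u ∂P ≤ r x * (M * ballVol d * b x) := by
    intro x hx
    rw [integral_const_mul]
    refine mul_le_mul_of_nonneg_left ?_ (hr0 x)
    rw [hP, integral_withDensity_eq_integral_toReal_smul hpm.ennreal_ofReal (by simp)]
    refine le_trans (le_of_eq ?_) (integral_abs_scaledKernel_mul_le S.bound_K S.supp_K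
      (S.h_pos hx) hp x (hb0 x hx) (hb x hx))
    refine integral_congr_ae (Filter.Eventually.of_forall fun u => ?_)
    simp only [hk, Set.indicator_of_mem hx, ENNReal.toReal_ofReal (hp u), smul_eq_mul, mul_comm]
  have hbI : BddMeas (B.indicator b) := S.bddMeas_indicator hbm ⟨cb, fun x hx => by
    rw [abs_of_nonneg (hb0 x hx)]; exact hcb x hx⟩
  calc ∫ u, ∫ v, (∫ x in B, locKernel K h ω B x u * locKernel K h ω B x v) ^ 2 ∂P ∂P
      ≤ ∫ u, ∫ v, C₁ * (∫ x in B, (r x * k x u) * (r x * k x v)) ∂P ∂P := by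
        have b1 : BddMeas (fun q : Space d × Space d =>
          (∫ x in B, locKernel K h ω B x q.1 * locKernel K h ω B x q.2) ^ 2) :=
          (S.bddMeas_locKernel.gram _).sq
        have b2 : BddMeas (fun q : Space d × Space d =>
          C₁ * ∫ x in B, (r x * k x q.1) * (r x * k x q.2)) :=
          (BddMeas.const C₁).mul (BddMeas.gram (f := fun x u => r x * k x u) hrk _)
        refine integral_mono
          ((BddMeas.integral_right (f := fun u v =>
            (∫ x in B, locKernel K h ω B x u * locKernel K h ω B x v) ^ 2) b1 P).integrable P)
          ((BddMeas.integral_right (f := fun u v =>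
            C₁ * ∫ x in B, (r x * k x u) * (r x * k x v)) b2 P).integrable P) fun u => ?_
        exact integral_mono
          ((BddMeas.right (f := fun u v =>
            (∫ x in B, locKernel K h ω B x u * locKernel K h ω B x v) ^ 2) b1 u).integrable P)
          ((BddMeas.right (f := fun u v =>
            C₁ * ∫ x in B, (r x * k x u) * (r x * k x v)) b2 u).integrable P) (hpt u)
    _ = C₁ * ∫ x in B, (∫ u, r x * k x u ∂P) ^ 2 := by
        have := integral_sq_integral_mul (μ := volume.restrict B) (P := P)
          (f := fun x u => r x * k x u) hrk (BddMeas.const 1)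
        simp only [one_mul] at this
        rw [this]
        simp only [integral_const_mul]
    _ ≤ C₁ * ∫ x in B, (r x * (M * ballVol d * B.indicator b x)) ^ 2 := by
        refine mul_le_mul_of_nonneg_left ?_ (by positivity)
        refine setIntegral_mono_on
          ((BddMeas.integral_right (f := fun x u => r x * k x u) hrk P).sq.integrable _)
          ((hrm.mul ((BddMeas.const _).mul hbI)).sq.integrable _) S.meas_B fun x hx => ?_
        rw [Set.indicator_of_mem hx]
        exact pow_le_pow_left₀ (integral_nonneg fun u => mul_nonneg (hr0 x) (hk0 x u))
          (hkP x hx) 2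
    _ = C₁ * ∫ x in B, (M * ballVol d) ^ 2 * (ω x ^ 2 / h x ^ d * b x ^ 2) := by
        congr 1
        refine setIntegral_congr_fun S.meas_B fun x hx => ?_
        have hh := S.h_pos hx
        simp only [hr, Set.indicator_of_mem hx, mul_pow, div_pow]
        rw [Real.sq_sqrt (by positivity)]
        ring
    _ = _ := by rw [integral_const_mul]; ring

end LocalSetup

/-! ### Identities between powers -/

section Powers

/-- The identities of this section relate monomials with real exponents: once every variable is
written as an exponential, they become linear identities between exponents. -/
lemma exists_exp_eq {x : ℝ} (hx : 0 < x) : ∃ y, x = Real.exp y :=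
  ⟨Real.log x, (Real.exp_log hx).symm⟩

/-- The separation scale of the statistic, in terms of `L`, `n` and `ℐ`. -/
def sepScale (d : ℕ) (α L n I : ℝ) : ℝ :=
  L ^ (2 * (d : ℝ) / (4 * α + d)) * I ^ ((2 * α + d) / (4 * α + d)) / n ^ (4 * α / (4 * α + d))

/-- The quantity `L^{d/(4α+d)} / (n² ℐ)^{α/(4α+d)}` from the definition of the cut-off `u_B`. -/
def cutScale (d : ℕ) (α L n I : ℝ) : ℝ :=
  L ^ ((d : ℝ) / (4 * α + d)) / (n ^ 2 * I) ^ (α / (4 * α + d))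

variable {d : ℕ} {α t L n I x c : ℝ}

lemma sepScale_pos (hL : 0 < L) (hn : 0 < n) (hI : 0 < I) : 0 < sepScale d α L n I := by
  unfold sepScale; positivity

lemma cutScale_pos (hL : 0 < L) (hn : 0 < n) (hI : 0 < I) : 0 < cutScale d α L n I := by
  unfold cutScale; positivity

lemma bias_identity (hα : 0 < α) (ht : t ≤ 2) (hL : 0 < L) (hn : 0 < n) (hI : 0 < I)
    (hx : 0 < x) (hc : 0 < c) :
    x ^ ((2 * α * t - 4 * α) / ((4 - t) * α + d)) *
      (L * (c * (x ^ (2 / ((4 - t) * α + d)) / (n ^ 2 * L ^ 4 * I) ^ (1 / (4 * α + d)))) ^ α) ^ 2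
      = (c ^ α) ^ 2 * (sepScale d α L n I / I) * x ^ (2 * α * t / ((4 - t) * α + d)) := by
  have hD : (4 - t) * α + d ≠ 0 := by
    have : 0 < (4 - t) * α := mul_pos (by linarith) hα
    positivity
  have hD1 : α * (4 - t) + d ≠ 0 := by rwa [mul_comm α]
  have h4 : 4 * α + d ≠ 0 := by positivity
  obtain ⟨L, rfl⟩ := exists_exp_eq hL
  obtain ⟨n, rfl⟩ := exists_exp_eq hn
  obtain ⟨I, rfl⟩ := exists_exp_eq hI
  obtain ⟨x, rfl⟩ := exists_exp_eq hx
  obtain ⟨c, rfl⟩ := exists_exp_eq hc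
  simp only [sepScale, ← Real.rpow_natCast, ← Real.exp_mul, ← Real.exp_add, ← Real.exp_sub]
  congr 1
  push_cast
  field_simp
  ring

lemma variance_identity (hα : 0 < α) (ht : t ≤ 2) (hL : 0 < L) (hn : 0 < n) (hI : 0 < I)
    (hx : 0 < x) (hc : 0 < c) :
    (x ^ ((2 * α * t - 4 * α) / ((4 - t) * α + d))) ^ 2 /
      (c * (x ^ (2 / ((4 - t) * α + d)) / (n ^ 2 * L ^ 4 * I) ^ (1 / (4 * α + d)))) ^ d *
      x ^ 2 / n ^ 2
      = (1 / c ^ d) * (sepScale d α L n I ^ 2 / I) * x ^ (2 * α * t / ((4 - t) * α + d)) := by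
  have hD : (4 - t) * α + d ≠ 0 := by
    have : 0 < (4 - t) * α := mul_pos (by linarith) hα
    positivity
  have hD1 : α * (4 - t) + d ≠ 0 := by rwa [mul_comm α]
  have h4 : 4 * α + d ≠ 0 := by positivity
  obtain ⟨L, rfl⟩ := exists_exp_eq hL
  obtain ⟨n, rfl⟩ := exists_exp_eq hn
  obtain ⟨I, rfl⟩ := exists_exp_eq hI
  obtain ⟨x, rfl⟩ := exists_exp_eq hx
  obtain ⟨c, rfl⟩ := exists_exp_eq hc
  simp only [sepScale, one_div, ← Real.exp_neg, ← Real.rpow_natCast, ← Real.exp_mul, ← Real.exp_add,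
    ← Real.exp_sub]
  congr 1
  push_cast
  field_simp
  ring

lemma separation_identity (hα : 0 < α) (ht0 : 0 < t) (ht : t ≤ 2) (hL : 0 < L) (hn : 0 < n)
    (hI : 0 < I) :
    ((L ^ d / n ^ (2 * α) * (I ^ (1 / (2 * α * t / ((4 - t) * α + d)))) ^ (2 * α)) ^
      (1 / (4 * α + d))) ^ t = sepScale d α L n I ^ (t / 2) * I ^ (1 - t / 2) := by
  have hD : (4 - t) * α + d ≠ 0 := by
    have : 0 < (4 - t) * α := mul_pos (by linarith) hα
    positivity
  have hD1 : α * (4 - t) + d ≠ 0 := by rwa [mul_comm α]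
  have h4 : 4 * α + d ≠ 0 := by positivity
  obtain ⟨L, rfl⟩ := exists_exp_eq hL
  obtain ⟨n, rfl⟩ := exists_exp_eq hn
  obtain ⟨I, rfl⟩ := exists_exp_eq hI
  simp only [sepScale, ← Real.rpow_natCast, ← Real.exp_mul, ← Real.exp_add, ← Real.exp_sub]
  congr 1
  field_simp
  ring

/-- Above the cut-off, the bias bound `L h^α` is at most a quarter of the density. -/
lemma bandwidth_le_of_cut (hα : 0 < α) (ht : t ≤ 2) (hd : 1 ≤ d) (hL : 0 < L) (hn : 0 < n)
    (hI : 0 < I) (hx : 0 < x) {b : ℝ} (hb : 0 < b)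
    (hcut : (b * cutScale d α L n I) ^ (((4 - t) * α + d) / ((2 - t) * α + d)) ≤ 2 * x) :
    L * (((2 : ℝ) ^ (2 * α / ((4 - t) * α + d) - 1) * b / 4) ^ (1 / α) *
      (x ^ (2 / ((4 - t) * α + d)) / (n ^ 2 * L ^ 4 * I) ^ (1 / (4 * α + d)))) ^ α ≤ x / 4 := by
  have hd' : (0 : ℝ) < d := by exact_mod_cast hd
  have hD : 0 < (4 - t) * α + d := by
    have : 0 < (4 - t) * α := mul_pos (by linarith) hα
    positivity
  have hE : 0 < (2 - t) * α + d := by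
    have : 0 ≤ (2 - t) * α := mul_nonneg (by linarith) hα.le
    positivity
  have h4 : 4 * α + d ≠ 0 := by positivity
  have hG := cutScale_pos (d := d) (α := α) hL hn hI
  have hcut' : b * cutScale d α L n I ≤ (2 * x) ^ (((2 - t) * α + d) / ((4 - t) * α + d)) := by
    have := Real.rpow_le_rpow (by positivity) hcut
      (by positivity : 0 ≤ ((2 - t) * α + d) / ((4 - t) * α + d))
    rwa [← Real.rpow_mul (by positivity), div_mul_div_comm, mul_comm ((4 - t) * α + d),
      div_self (by positivity), Real.rpow_one] at this
  have h1 : L * (((2 : ℝ) ^ (2 * α / ((4 - t) * α + d) - 1) * b / 4) ^ (1 / α) *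
      (x ^ (2 / ((4 - t) * α + d)) / (n ^ 2 * L ^ 4 * I) ^ (1 / (4 * α + d)))) ^ α =
      (2 : ℝ) ^ (2 * α / ((4 - t) * α + d) - 1) / 4 * (b * cutScale d α L n I) *
        x ^ (2 * α / ((4 - t) * α + d)) := by
    rw [Real.mul_rpow (by positivity) (by positivity), ← Real.rpow_mul (by positivity),
      one_div_mul_cancel hα.ne', Real.rpow_one]
    have h3 : L * (x ^ (2 / ((4 - t) * α + d)) / (n ^ 2 * L ^ 4 * I) ^ (1 / (4 * α + d))) ^ α =
        cutScale d α L n I * x ^ (2 * α / ((4 - t) * α + d)) := by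
      have hD1 : α * (4 - t) + d ≠ 0 := by rw [mul_comm α]; exact hD.ne'
      obtain ⟨L, rfl⟩ := exists_exp_eq hL
      obtain ⟨n, rfl⟩ := exists_exp_eq hn
      obtain ⟨I, rfl⟩ := exists_exp_eq hI
      obtain ⟨x, rfl⟩ := exists_exp_eq hx
      simp only [cutScale, ← Real.rpow_natCast, ← Real.exp_mul, ← Real.exp_add, ← Real.exp_sub]
      congr 1
      push_cast
      field_simp
      ring
    rw [mul_left_comm, h3]
    ring
  have h2 : (2 : ℝ) ^ (2 * α / ((4 - t) * α + d) - 1) / 4 *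
      (2 * x) ^ (((2 - t) * α + d) / ((4 - t) * α + d)) * x ^ (2 * α / ((4 - t) * α + d)) =
      x / 4 := by
    have e : ((2 - t) * α + d) / ((4 - t) * α + d) = 1 - 2 * α / ((4 - t) * α + d) := by
      rw [eq_sub_iff_add_eq, ← add_div, div_eq_one_iff_eq hD.ne']; ring
    rw [e, Real.mul_rpow (by norm_num) hx.le, Real.rpow_sub (by norm_num),
      Real.rpow_sub (by norm_num), Real.rpow_sub hx, Real.rpow_one, Real.rpow_one]
    field_simp
  rw [h1, ← h2]
  gcongr

/-- If the tail does not dominate, the contribution of the values of the density between the cut-off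
and `u_aux` is controlled by `ℐ`. -/
lemma tail_contribution_le (hα : 0 < α) (ht1 : 1 ≤ t) (ht : t ≤ 2) (hd : 1 ≤ d) (hL : 0 < L)
    (hn : 0 < n) (hI : 0 < I) {b a C m : ℝ} (hb : 0 < b) (ha : 0 < a) (hC : 0 < C) (hm : 0 ≤ m)
    (h : ((L ^ d / n ^ (2 * α)) ^ (t - 1) * m ^ ((2 - t) * α + d)) ^ (1 / (t * (α + d))) ≤
      C * (L ^ d / n ^ (2 * α) *
        (I ^ (1 / (2 * α * t / ((4 - t) * α + d)))) ^ (2 * α)) ^ (1 / (4 * α + d))) :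
    ((b * cutScale d α L n I) ^ (((4 - t) * α + d) / ((2 - t) * α + d)) / 2) ^
        (2 * α * t / ((4 - t) * α + d) - 2) *
      (a * (L ^ d / n ^ (2 * α)) ^ (1 / (α + d)) * m ^ ((d : ℝ) / (α + d))) ≤
    ((b ^ (((4 - t) * α + d) / ((2 - t) * α + d)) / 2) ^ (2 * α * t / ((4 - t) * α + d) - 2) * a *
      (C ^ (t * (α + d))) ^ ((d : ℝ) / ((α + d) * ((2 - t) * α + d)))) * I := by
  have hd' : (0 : ℝ) < d := by exact_mod_cast hd
  have hD : 0 < (4 - t) * α + d := by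
    have : 0 < (4 - t) * α := mul_pos (by linarith) hα
    positivity
  have hE : 0 < (2 - t) * α + d := by
    have : 0 ≤ (2 - t) * α := mul_nonneg (by linarith) hα.le
    positivity
  have h4 : 0 < 4 * α + d := by positivity
  have ht0 : 0 < t := by linarith
  have hG := cutScale_pos (d := d) (α := α) hL hn hI
  set l := L ^ d / n ^ (2 * α) with hl
  have hl0 : 0 < l := by positivity
  set ρ := (l * (I ^ (1 / (2 * α * t / ((4 - t) * α + d)))) ^ (2 * α)) ^ (1 / (4 * α + d)) with hρ
  have hρ0 : 0 < ρ := by positivity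
  have h1 : m ^ ((2 - t) * α + d) ≤ l ^ (1 - t) * (C * ρ) ^ (t * (α + d)) := by
    have := Real.rpow_le_rpow (by positivity) h (by positivity : 0 ≤ t * (α + d))
    rw [← Real.rpow_mul (by positivity), one_div_mul_cancel (by positivity), Real.rpow_one] at this
    calc m ^ ((2 - t) * α + d) = l ^ (1 - t) * (l ^ (t - 1) * m ^ ((2 - t) * α + d)) := by
          rw [← mul_assoc, ← Real.rpow_add hl0]; simp
      _ ≤ _ := by gcongr
  have h2 : m ^ ((d : ℝ) / (α + d)) ≤
      (l ^ (1 - t) * (C * ρ) ^ (t * (α + d))) ^ ((d : ℝ) / ((α + d) * ((2 - t) * α + d))) := by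
    have := Real.rpow_le_rpow (by positivity) h1
      (by positivity : 0 ≤ (d : ℝ) / ((α + d) * ((2 - t) * α + d)))
    rwa [← Real.rpow_mul hm, show ((2 - t) * α + d) * ((d : ℝ) / ((α + d) * ((2 - t) * α + d))) =
      (d : ℝ) / (α + d) by field_simp] at this
  refine (mul_le_mul_of_nonneg_left (mul_le_mul_of_nonneg_left h2 (by positivity))
    (by positivity)).trans (le_of_eq ?_)
  rw [Real.mul_rpow hb.le hG.le, mul_div_right_comm, Real.mul_rpow (by positivity) (by positivity),
    Real.mul_rpow hC.le hρ0.le, mul_left_comm (l ^ (1 - t)),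
    Real.mul_rpow (x := C ^ (t * (α + d))) (by positivity) (by positivity)]
  have key : (cutScale d α L n I ^ (((4 - t) * α + d) / ((2 - t) * α + d))) ^
      (2 * α * t / ((4 - t) * α + d) - 2) * (l ^ (1 / (α + d)) *
      (l ^ (1 - t) * ρ ^ (t * (α + d))) ^ ((d : ℝ) / ((α + d) * ((2 - t) * α + d)))) = I := by
    clear h h1 h2 hG hρ0 hl0
    simp only [hρ, hl]
    clear_value l ρ
    have hD1 : α * (4 - t) + d ≠ 0 := by rw [mul_comm α]; exact hD.ne'
    have hE1 : α * (2 - t) + d ≠ 0 := by rw [mul_comm α]; exact hE.ne'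
    obtain ⟨L, rfl⟩ := exists_exp_eq hL
    obtain ⟨n, rfl⟩ := exists_exp_eq hn
    obtain ⟨I, rfl⟩ := exists_exp_eq hI
    simp only [cutScale, ← Real.rpow_natCast, ← Real.exp_mul, ← Real.exp_add, ← Real.exp_sub]
    congr 1
    push_cast
    field_simp
    ring
  conv_rhs => rw [← key]
  ring

end Powers

/-! ### Densities -/

section Densities

variable {d : ℕ} {α L c : ℝ}

lemma continuous_of_mem_holderClass (hα : 0 < α) {f : Space d → ℝ} (hf : f ∈ holderClass d α L) :
    Continuous f := by
  rcases Nat.eq_zero_or_pos (⌈α⌉₊ - 1) with h0 | h0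
  · have hL : ∀ x y, |f y - f x| ≤ L * ‖x - y‖ ^ α := fun x y => by
      simpa [h0, taylorPoly] using hf.2 x y
    refine continuous_iff_continuousAt.2 fun x => ?_
    rw [ContinuousAt, tendsto_iff_dist_tendsto_zero]
    have hlim : Filter.Tendsto (fun y => L * ‖x - y‖ ^ α) (nhds x) (nhds 0) := by
      have h1 : Continuous fun y : Space d => L * ‖x - y‖ ^ α :=
        continuous_const.mul
          ((continuous_const.sub continuous_id).norm.rpow_const fun _ => Or.inr hα.le)
      simpa [Real.zero_rpow hα.ne'] using h1.tendsto x
    exact squeeze_zero (fun _ => dist_nonneg) (fun y => by rw [Real.dist_eq]; exact hL x y) hlim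
  · have h1 := (hf.1 0 h0).continuous
    have h2 : Continuous fun x => iteratedFDeriv ℝ 0 f x 0 := by fun_prop
    simpa only [iteratedFDeriv_zero_apply] using h2

lemma isProbabilityMeasure_of_mem_densityClass {p : Space d → ℝ} (hp : p ∈ densityClass d α L c) :
    IsProbabilityMeasure (volume.withDensity fun x => ENNReal.ofReal (p x)) := by
  obtain ⟨-, h0, hi, h1, -⟩ := hp
  refine ⟨?_⟩
  rw [withDensity_apply _ MeasurableSet.univ, Measure.restrict_univ,
    ← ofReal_integral_eq_lintegral_ofReal hi (Filter.Eventually.of_forall h0), h1,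
    ENNReal.ofReal_one]

lemma densityClass_mono {δ : ℝ} (hL : 0 ≤ L) (hc : 0 ≤ c) (hδ : 0 ≤ δ) {p : Space d → ℝ}
    (hp : p ∈ densityClass d α L c) : p ∈ densityClass d α ((1 + δ) * L) ((1 + δ) * c) := by
  obtain ⟨hH, h0, hi, h1, hm⟩ := hp
  have hL' : L ≤ (1 + δ) * L := by nlinarith
  have hc' : c ≤ (1 + δ) * c := by nlinarith
  refine ⟨⟨hH.1, fun x y => (hH.2 x y).trans ?_⟩, h0, hi, h1, fun x y => (hm x y).trans ?_⟩
  · gcongr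
  · have := h0 x
    gcongr

/-- A density that varies slowly is bounded, since it has to integrate to one. -/
lemma exists_bound_of_mem_densityClass (hα : 0 < α) (hL : 0 ≤ L) (hc : c < 1) {p : Space d → ℝ}
    (hp : p ∈ densityClass d α L c) : ∃ V, ∀ x, p x ≤ V := by
  obtain ⟨-, h0, hi, h1, hm⟩ := hp
  have hv : 0 < ballVol d := by
    unfold ballVol
    exact ENNReal.toReal_pos (Metric.measure_ball_pos _ _ one_pos).ne' measure_ball_lt_top.ne
  refine ⟨(1 / ballVol d + L) / (1 - c), fun x => ?_⟩
  have hlow : ∀ y ∈ Metric.closedBall x 1, (1 - c) * p x - L ≤ p y := by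
    intro y hy
    rw [Metric.mem_closedBall, dist_comm, dist_eq_norm] at hy
    have h2 : ‖x - y‖ ^ α ≤ 1 := Real.rpow_le_one (norm_nonneg _) hy hα.le
    have h3 := le_of_abs_le (hm x y)
    nlinarith
  have h4 : ballVol d * ((1 - c) * p x - L) ≤ 1 := by
    calc ballVol d * ((1 - c) * p x - L)
        = ∫ _ in Metric.closedBall x 1, ((1 - c) * p x - L) := by
          rw [setIntegral_const, volume_real_closedBall_le _ zero_le_one, smul_eq_mul, one_pow,
            one_mul]
      _ ≤ ∫ y in Metric.closedBall x 1, p y :=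
          setIntegral_mono_on (integrableOn_const measure_closedBall_lt_top.ne)
            hi.integrableOn measurableSet_closedBall hlow
      _ ≤ ∫ y, p y := setIntegral_le_integral hi (Filter.Eventually.of_forall h0)
      _ = 1 := h1
  rw [le_div_iff₀ (by linarith)]
  have h5 : (1 - c) * p x - L ≤ 1 / ballVol d := by
    rw [le_div_iff₀ hv]; linarith
  linarith

end Densities

/-! ### The cut-offs -/

section CutOffs

variable {d : ℕ} {n : ℕ} {α t L cAux cB CBT : ℝ} {p₀ : Space d → ℝ}

lemma measurableSet_bulkSet (hp : Measurable p₀) (u : ℝ≥0∞) : MeasurableSet (bulkSet p₀ u) :=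
  measurableSet_le measurable_const hp.ennreal_ofReal

lemma measurableSet_tailSet (hp : Measurable p₀) (u : ℝ≥0∞) : MeasurableSet (tailSet p₀ u) :=
  measurableSet_lt hp.ennreal_ofReal measurable_const

/-- The supremum defining `u_aux` is attained, by monotone convergence. -/
lemma setIntegral_tail_sq_le (hm : Measurable p₀) (h0 : ∀ x, 0 ≤ p₀ x) (hi : Integrable p₀)
    (hi2 : Integrable fun x => p₀ x ^ 2) (hα : 0 < α) (hd : 1 ≤ d) (hL : 0 < L)
    (hcAux : 0 < cAux) :
    ∫ x in tailSet p₀ (uAux n α L cAux p₀), p₀ x ^ 2 ≤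
      cAux * LTilde d n α L ^ (1 / (α + d)) *
        (∫ x in tailSet p₀ (uAux n α L cAux p₀), p₀ x) ^ ((d : ℝ) / (α + d)) := by
  have hd' : (0 : ℝ) < d := by exact_mod_cast hd
  set 𝒰 : Set ℝ≥0∞ := {u : ℝ≥0∞ | u ≠ ∞ ∧
    (∫ x in tailSet p₀ u, p₀ x ^ 2) / (∫ x in tailSet p₀ u, p₀ x) ^ ((d : ℝ) / (α + d)) ≤
      cAux * LTilde d n α L ^ (1 / (α + d))} with h𝒰
  have hLt : 0 ≤ LTilde d n α L := by unfold LTilde; positivity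
  have hne : 𝒰.Nonempty := by
    refine ⟨0, ENNReal.zero_ne_top, ?_⟩
    have : tailSet p₀ 0 = ∅ := by ext x; simp [tailSet]
    simp only [this, Measure.restrict_empty, integral_zero_measure, zero_div]
    positivity
  have hq0 : ∀ s : Set (Space d), 0 ≤ ∫ x in s, p₀ x := fun s => integral_nonneg h0
  obtain ⟨u, hu_mono, hu_lim, hu_mem⟩ := exists_seq_tendsto_sSup hne (OrderTop.bddAbove _)
  have hmono : Monotone fun j => tailSet p₀ (u j) := fun i j hij x hx =>
    lt_of_lt_of_le hx (hu_mono hij)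
  have hunion : ⋃ j, tailSet p₀ (u j) = tailSet p₀ (sSup 𝒰) := by
    ext x
    simp only [Set.mem_iUnion]
    constructor
    · rintro ⟨j, hj⟩
      exact lt_of_lt_of_le hj (le_sSup (hu_mem j))
    · intro hx
      exact (hu_lim.eventually (lt_mem_nhds hx)).exists
  have hlim := tendsto_setIntegral_of_monotone (f := fun x => p₀ x ^ 2) (μ := volume)
    (fun j => measurableSet_tailSet hm (u j)) hmono hi2.integrableOn
  rw [hunion] at hlim
  refine le_of_tendsto' hlim fun j => ?_
  have hstep : ∫ x in tailSet p₀ (u j), p₀ x ^ 2 ≤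
      cAux * LTilde d n α L ^ (1 / (α + d)) *
        (∫ x in tailSet p₀ (u j), p₀ x) ^ ((d : ℝ) / (α + d)) := by
    rcases (hq0 (tailSet p₀ (u j))).eq_or_lt with hz | hz
    · have hae := (setIntegral_eq_zero_iff_of_nonneg_ae (Filter.Eventually.of_forall h0)
        hi.integrableOn).1 hz.symm
      have : ∫ x in tailSet p₀ (u j), p₀ x ^ 2 = 0 := by
        rw [integral_eq_zero_of_ae]
        filter_upwards [hae] with x hx
        rw [hx]; simp
      rw [this]
      have := hq0 (tailSet p₀ (u j))
      positivity
    · exact (div_le_iff₀ (Real.rpow_pos_of_pos hz _)).1 (hu_mem j).2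
  refine hstep.trans ?_
  have hle : ∫ x in tailSet p₀ (u j), p₀ x ≤ ∫ x in tailSet p₀ (sSup 𝒰), p₀ x :=
    setIntegral_mono_set hi.integrableOn (Filter.Eventually.of_forall h0)
      (Filter.Eventually.of_forall fun x (hx : _ < _) => lt_of_lt_of_le hx (le_sSup (hu_mem j)))
  exact mul_le_mul_of_nonneg_left (Real.rpow_le_rpow (hq0 _) hle (by positivity)) (by positivity)

lemma bulkI_nonneg (h0 : ∀ x, 0 ≤ p₀ x) : 0 ≤ bulkI n α t L cAux p₀ :=
  integral_nonneg fun x => Real.rpow_nonneg (h0 x) _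

lemma rExp_pos (hα : 0 < α) (ht1 : 1 ≤ t) (ht : t ≤ 2) : 0 < rExp d α t := by
  have : 0 < (4 - t) * α := mul_pos (by linarith) hα
  unfold rExp
  positivity

lemma bulkI_pos_of_rhoBulk_pos (hα : 0 < α) (ht1 : 1 ≤ t) (ht : t ≤ 2) (h0 : ∀ x, 0 ≤ p₀ x)
    (h : 0 < rhoBulk n α t L cAux p₀) : 0 < bulkI n α t L cAux p₀ := by
  refine (bulkI_nonneg h0).lt_of_ne fun hI => h.ne' ?_
  rw [rhoBulk, ← hI, Real.zero_rpow (by have := rExp_pos (d := d) hα ht1 ht; positivity),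
    Real.zero_rpow (by positivity), mul_zero, Real.zero_rpow (by positivity)]

lemma le_of_mem_bulkTilde (h0 : ∀ x, 0 ≤ p₀ x) {x : Space d}
    (hx : x ∈ bulkTilde n α t L cAux cB CBT p₀) :
    (cB * cutScale d α L n (bulkI n α t L cAux p₀)) ^ (((4 - t) * α + d) / ((2 - t) * α + d)) / 2 ≤
      p₀ x := by
  have h1 : uB n α t L cAux cB p₀ / 2 ≤ uTilde n α t L cAux cB CBT p₀ := by
    unfold uTilde
    split_ifs
    · exact le_rfl
    · exact ENNReal.half_le_self
  have h2 : ENNReal.ofReal ((cB * cutScale d α L n (bulkI n α t L cAux p₀)) ^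
      (((4 - t) * α + d) / ((2 - t) * α + d)) / 2) ≤ uB n α t L cAux cB p₀ / 2 := by
    rw [ENNReal.ofReal_div_of_pos two_pos, ENNReal.ofReal_ofNat]
    exact ENNReal.div_le_div_right (le_max_right _ _) 2
  exact (ENNReal.ofReal_le_ofReal_iff (h0 x)).1 (h2.trans (h1.trans hx))

/-- The integral of `p₀^r` over the enlarged bulk is of the order of `ℐ`. -/
lemma exists_setIntegral_bulkTilde_le (hα : 0 < α) (ht1 : 1 ≤ t) (ht : t ≤ 2) (hd : 1 ≤ d)
    (hcAux : 0 < cAux) (hcB : 0 < cB) (hCBT : 0 < CBT) :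
    ∃ C : ℝ, 0 < C ∧ ∀ (n : ℕ) (L : ℝ) (p₀ : Space d → ℝ), 0 < n → 0 < L → Measurable p₀ →
      (∀ x, 0 ≤ p₀ x) → Integrable p₀ → Integrable (fun x => p₀ x ^ 2) →
      0 < bulkI n α t L cAux p₀ →
      IntegrableOn (fun x => p₀ x ^ rExp d α t) (bulkTilde n α t L cAux cB CBT p₀) ∧
      ∫ x in bulkTilde n α t L cAux cB CBT p₀, p₀ x ^ rExp d α t ≤
        C * bulkI n α t L cAux p₀ := by
  have hd' : (0 : ℝ) < d := by exact_mod_cast hd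
  set C₁ := (cB ^ (((4 - t) * α + d) / ((2 - t) * α + d)) / 2) ^
    (2 * α * t / ((4 - t) * α + d) - 2) * cAux *
      (CBT ^ (t * (α + d))) ^ ((d : ℝ) / ((α + d) * ((2 - t) * α + d))) with hC₁
  refine ⟨1 + C₁, by positivity, fun n L p₀ hn hL hm h0 hi hi2 hI => ?_⟩
  have hn' : (0 : ℝ) < n := by exact_mod_cast hn
  have hIB : IntegrableOn (fun x => p₀ x ^ rExp d α t) (bulkSet p₀ (uAux n α L cAux p₀)) := by
    by_contra hcon
    rw [bulkI, integral_undef hcon] at hI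
    exact lt_irrefl _ hI
  have hr0 : ∀ x, 0 ≤ p₀ x ^ rExp d α t := fun x => Real.rpow_nonneg (h0 x) _
  have hC₁0 : 0 ≤ C₁ := by positivity
  by_cases hcase : rhoTail n α t L cAux cB p₀ ≤ CBT * rhoBulk n α t L cAux p₀
  swap
  · have hsub : bulkTilde n α t L cAux cB CBT p₀ ⊆ bulkSet p₀ (uAux n α L cAux p₀) := by
      intro x hx
      rw [bulkTilde, uTilde, if_neg hcase] at hx
      have hx' : uB n α t L cAux cB p₀ ≤ ENNReal.ofReal (p₀ x) := hx
      exact (le_max_left (uAux n α L cAux p₀) _).trans hx'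
    refine ⟨hIB.mono_set hsub, ?_⟩
    have : ∫ x in bulkTilde n α t L cAux cB CBT p₀, p₀ x ^ rExp d α t ≤
        bulkI n α t L cAux p₀ :=
      setIntegral_mono_set hIB (Filter.Eventually.of_forall hr0)
        (Filter.Eventually.of_forall hsub)
    nlinarith
  set v := (cB * cutScale d α L n (bulkI n α t L cAux p₀)) ^
    (((4 - t) * α + d) / ((2 - t) * α + d)) / 2 with hv
  have hv0 : 0 < v := by
    have := cutScale_pos (d := d) (α := α) hL hn' hI
    positivity
  set Bt := bulkTilde n α t L cAux cB CBT p₀ with hBt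
  set B := bulkSet p₀ (uAux n α L cAux p₀) with hB
  set T := tailSet p₀ (uAux n α L cAux p₀) with hT
  have hBtm : MeasurableSet Bt := measurableSet_bulkSet hm _
  have hTm : MeasurableSet T := measurableSet_tailSet hm _
  have hr2 : rExp d α t - 2 ≤ 0 := by
    have hD : 0 < (4 - t) * α + d := by
      have : 0 < (4 - t) * α := mul_pos (by linarith) hα
      positivity
    rw [rExp, sub_nonpos, div_le_iff₀ hD]
    nlinarith
  -- Between the two cut-offs, `p₀^r` is at most a multiple of `p₀²`, because `r ≤ 2`.
  have hpt : ∀ x ∈ Bt ∩ T, p₀ x ^ rExp d α t ≤ v ^ (rExp d α t - 2) * p₀ x ^ 2 := by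
    intro x hx
    have hvx : v ≤ p₀ x := le_of_mem_bulkTilde h0 hx.1
    have hpx : 0 < p₀ x := hv0.trans_le hvx
    calc p₀ x ^ rExp d α t = p₀ x ^ (rExp d α t - 2) * p₀ x ^ 2 := by
          rw [← Real.rpow_natCast (p₀ x) 2, ← Real.rpow_add hpx]; simp
      _ ≤ v ^ (rExp d α t - 2) * p₀ x ^ 2 := by
          have := Real.rpow_le_rpow_of_nonpos hv0 hvx hr2
          gcongr
  have hi2' : Integrable (fun x => v ^ (rExp d α t - 2) * p₀ x ^ 2) := hi2.const_mul _
  have hIT : IntegrableOn (fun x => p₀ x ^ rExp d α t) (Bt ∩ T) := by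
    refine hi2'.integrableOn.mono' ((hm.pow_const _).aestronglyMeasurable) ?_
    filter_upwards [ae_restrict_mem (hBtm.inter hTm)] with x hx
    rw [Real.norm_of_nonneg (hr0 x)]
    exact hpt x hx
  have hsub : Bt ⊆ B ∪ (Bt ∩ T) := by
    intro x hx
    by_cases hxT : x ∈ T
    · exact Or.inr ⟨hx, hxT⟩
    · have hxT' : ¬ ENNReal.ofReal (p₀ x) < uAux n α L cAux p₀ := hxT
      exact Or.inl (not_lt.1 hxT')
  have hIU : IntegrableOn (fun x => p₀ x ^ rExp d α t) (B ∪ (Bt ∩ T)) := hIB.union hIT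
  refine ⟨hIU.mono_set hsub, ?_⟩
  have hdisj : Disjoint B (Bt ∩ T) := by
    refine Set.disjoint_left.2 fun x hxB hxT => ?_
    have h1 : uAux n α L cAux p₀ ≤ ENNReal.ofReal (p₀ x) := hxB
    have h2 : ENNReal.ofReal (p₀ x) < uAux n α L cAux p₀ := hxT.2
    exact absurd h2 (not_lt.2 h1)
  have hmT : ∫ x in T, p₀ x ≤ ∫ x in tailSet p₀ (uB n α t L cAux cB p₀), p₀ x :=
    setIntegral_mono_set hi.integrableOn (Filter.Eventually.of_forall h0)
      (Filter.Eventually.of_forall fun x (hx : _ < _) => lt_of_lt_of_le hx (le_max_left _ _))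
  have hmT0 : 0 ≤ ∫ x in T, p₀ x := integral_nonneg h0
  have hLt : 0 ≤ LTilde d n α L := by unfold LTilde; positivity
  have htail : ∫ x in Bt ∩ T, p₀ x ^ rExp d α t ≤ C₁ * bulkI n α t L cAux p₀ := by
    calc ∫ x in Bt ∩ T, p₀ x ^ rExp d α t
        ≤ ∫ x in Bt ∩ T, v ^ (rExp d α t - 2) * p₀ x ^ 2 :=
          setIntegral_mono_on hIT hi2'.integrableOn (hBtm.inter hTm) hpt
      _ ≤ ∫ x in T, v ^ (rExp d α t - 2) * p₀ x ^ 2 :=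
          setIntegral_mono_set hi2'.integrableOn
            (Filter.Eventually.of_forall fun x => by simp only [Pi.zero_apply]; positivity)
            (Filter.Eventually.of_forall Set.inter_subset_right)
      _ = v ^ (rExp d α t - 2) * ∫ x in T, p₀ x ^ 2 := integral_const_mul _ _
      _ ≤ v ^ (rExp d α t - 2) * (cAux * LTilde d n α L ^ (1 / (α + d)) *
            (∫ x in T, p₀ x) ^ ((d : ℝ) / (α + d))) := by
          gcongr
          exact setIntegral_tail_sq_le hm h0 hi hi2 hα hd hL hcAux
      _ ≤ v ^ (rExp d α t - 2) * (cAux * LTilde d n α L ^ (1 / (α + d)) *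
            (∫ x in tailSet p₀ (uB n α t L cAux cB p₀), p₀ x) ^ ((d : ℝ) / (α + d))) := by
          gcongr
      _ ≤ _ := tail_contribution_le hα ht1 ht hd hL hn' hI hcB hcAux hCBT
          (integral_nonneg h0) hcase
  calc ∫ x in Bt, p₀ x ^ rExp d α t
      ≤ ∫ x in B ∪ (Bt ∩ T), p₀ x ^ rExp d α t :=
        setIntegral_mono_set hIU (Filter.Eventually.of_forall hr0)
          (Filter.Eventually.of_forall hsub)
    _ = bulkI n α t L cAux p₀ + ∫ x in Bt ∩ T, p₀ x ^ rExp d α t := by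
        rw [setIntegral_union hdisj (hBtm.inter hTm) hIB hIT]; rfl
    _ ≤ (1 + C₁) * bulkI n α t L cAux p₀ := by linarith

end CutOffs

/-! ### Mean and variance of the test statistic -/

/-- The situation on the bulk, together with the orders of magnitude that make the test work: in
terms of the separation scale `τ` and of the integral `ℐ`, the squared bias `ω (L h^α)²` is of the
order `(τ / ℐ) p₀^r`, the variance density `ω² p₀² / (n² h^d)` is of the order `(τ² / ℐ) p₀^r`, and
`∫_B p₀^r` is of the order of `ℐ`. The constants are `c₂`, `c₁` and `c₃`, in this order. -/
structure BulkSetup {d : ℕ} (K p₀ h ω : Space d → ℝ) (B : Set (Space d))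
    (M κ e α L r τ I n c₁ c₂ c₃ : ℝ) : Prop extends LocalSetup K p₀ h ω B M κ e where
  α_pos : 0 < α
  L_pos : 0 < L
  τ_pos : 0 < τ
  I_pos : 0 < I
  n_pos : 0 < n
  c₁_pos : 0 < c₁
  c₂_pos : 0 < c₂
  c₃_pos : 0 < c₃
  ω_pos : ∀ x ∈ B, 0 < ω x
  bias_small : ∀ x ∈ B, L * h x ^ α ≤ p₀ x / 4
  bias_eq : ∀ x ∈ B, ω x * (L * h x ^ α) ^ 2 = c₂ * (τ / I) * p₀ x ^ r
  variance_eq : ∀ x ∈ B, ω x ^ 2 / h x ^ d * p₀ x ^ 2 / n ^ 2 = c₁ * (τ ^ 2 / I) * p₀ x ^ r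
  integrableOn_rpow : IntegrableOn (fun x => p₀ x ^ r) B
  integral_rpow_le : ∫ x in B, p₀ x ^ r ≤ c₃ * I

lemma LocalSetup.integrableOn {d : ℕ} {K p₀ h ω : Space d → ℝ} {B : Set (Space d)} {M κ e : ℝ}
    (S : LocalSetup K p₀ h ω B M κ e) {c : Space d → ℝ} (hc : Measurable c)
    (hcb : ∃ C, ∀ x ∈ B, |c x| ≤ C) : IntegrableOn c B := by
  have := S.isFiniteMeasure
  have h1 := (S.bddMeas_indicator hc hcb).integrable (volume.restrict B)
  exact h1.congr (by filter_upwards [ae_restrict_mem S.meas_B] with x hx using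
    Set.indicator_of_mem hx c)

/-- The weighted squared distance `∫_B ω (p - p₀)²`. -/
def sqDist {d : ℕ} (ω p p₀ : Space d → ℝ) (B : Set (Space d)) : ℝ := ∫ x in B, ω x * (p x - p₀ x) ^ 2

lemma card_firstHalf (k : ℕ) : (firstHalf k).card = k := by
  have h : (firstHalf k).map Fin.valEmbedding = Finset.range k := by
    ext i
    simp only [firstHalf, Finset.mem_map, Finset.mem_filter, Finset.mem_univ, true_and,
      Fin.valEmbedding_apply, Finset.mem_range]
    exact ⟨fun ⟨j, hj, hji⟩ => hji ▸ hj, fun hi => ⟨⟨i, by omega⟩, hi, rfl⟩⟩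
  rw [← Finset.card_map Fin.valEmbedding, h, Finset.card_range]

lemma card_secondHalf (k : ℕ) : (secondHalf k).card = k := by
  have h : (secondHalf k).map Fin.valEmbedding = Finset.Ico k (2 * k) := by
    ext i
    simp only [secondHalf, Finset.mem_map, Finset.mem_filter, Finset.mem_univ, true_and,
      Fin.valEmbedding_apply, Finset.mem_Ico]
    exact ⟨fun ⟨j, hj, hji⟩ => hji ▸ ⟨hj, j.2⟩, fun hi => ⟨⟨i, hi.2⟩, hi.1, rfl⟩⟩
  rw [← Finset.card_map Fin.valEmbedding, h, Nat.card_Ico]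
  omega

/-- The constant in the moment bounds for the test statistic. -/
def momentConst (d : ℕ) (M e c₁ c₂ c₃ b : ℝ) : ℝ :=
  2 * b ^ 2 * c₂ * c₃ + 1 + 24 * ((M ^ 2 * ((8 : ℝ) ^ e) ^ d * ballVol d * (M * ballVol d) ^ 2) *
    (18 * c₁ * c₃ + c₁ / (2 * c₂)) + 1)

namespace BulkSetup

variable {d : ℕ} {K p₀ h ω : Space d → ℝ} {B : Set (Space d)}
  {M κ e α L r τ I n c₁ c₂ c₃ : ℝ}

lemma sqDist_nonneg (S : BulkSetup K p₀ h ω B M κ e α L r τ I n c₁ c₂ c₃) (p : Space d → ℝ) :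
    0 ≤ sqDist ω p p₀ B :=
  integral_nonneg fun x => mul_nonneg (S.ω_nonneg x) (sq_nonneg _)

lemma integrableOn_weight_mul_sq (S : BulkSetup K p₀ h ω B M κ e α L r τ I n c₁ c₂ c₃)
    {f : Space d → ℝ} (hf : Measurable f) (hfb : ∃ C, ∀ x ∈ B, |f x| ≤ C) :
    IntegrableOn (fun x => ω x * f x ^ 2) B := by
  obtain ⟨C, hC⟩ := hfb
  obtain ⟨c, hc⟩ := S.ω_bdd
  refine S.integrableOn (S.meas_ω.mul (hf.pow_const 2)) ⟨c * C ^ 2, fun x hx => ?_⟩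
  have h0 := S.ω_nonneg x
  rw [abs_mul, abs_of_nonneg h0, abs_pow]
  exact mul_le_mul (hc x hx) (pow_le_pow_left₀ (abs_nonneg _) (hC x hx) 2) (by positivity)
    (h0.trans (hc x hx))

lemma bdd_sub (S : BulkSetup K p₀ h ω B M κ e α L r τ I n c₁ c₂ c₃) {p : Space d → ℝ}
    (hp0 : ∀ x, 0 ≤ p x) (hpb : ∃ V, ∀ x, p x ≤ V) : ∃ C, ∀ x ∈ B, |p x - p₀ x| ≤ C := by
  obtain ⟨V, hV⟩ := hpb
  obtain ⟨V₀, hV₀⟩ := S.p₀_upper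
  refine ⟨V + V₀, fun x hx => (abs_sub _ _).trans (add_le_add ?_ ?_)⟩
  · rw [abs_of_nonneg (hp0 x)]; exact hV x
  · rw [abs_of_pos (S.p₀_pos hx)]; exact hV₀ x hx

/-- On the bulk the variance factor `ω / (n² h^d)` is at most of the order of `τ`. This combines the
two orders of magnitude with `L h^α ≤ p₀ / 4`. -/
lemma weight_div_le (S : BulkSetup K p₀ h ω B M κ e α L r τ I n c₁ c₂ c₃) {x : Space d}
    (hx : x ∈ B) : ω x / h x ^ d / n ^ 2 ≤ c₁ / (16 * c₂) * τ := by
  have hω := S.ω_pos x hx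
  have hp := S.p₀_pos hx
  have hh := S.h_pos hx
  have hn := S.n_pos
  have hτ := S.τ_pos
  have hI := S.I_pos
  have h1 := S.c₁_pos
  have h2 := S.c₂_pos
  have hL := S.L_pos
  have hsq : (L * h x ^ α) ^ 2 ≤ p₀ x ^ 2 / 16 := by
    calc (L * h x ^ α) ^ 2 ≤ (p₀ x / 4) ^ 2 :=
          pow_le_pow_left₀ (by positivity) (S.bias_small x hx) 2
      _ = _ := by ring
  have key : (ω x / h x ^ d / n ^ 2) * (ω x * p₀ x ^ 2) ≤
      (c₁ / (16 * c₂) * τ) * (ω x * p₀ x ^ 2) := by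
    calc (ω x / h x ^ d / n ^ 2) * (ω x * p₀ x ^ 2)
        = ω x ^ 2 / h x ^ d * p₀ x ^ 2 / n ^ 2 := by ring
      _ = c₁ / c₂ * τ * (c₂ * (τ / I) * p₀ x ^ r) := by
          rw [S.variance_eq x hx]; field_simp
      _ = c₁ / c₂ * τ * (ω x * (L * h x ^ α) ^ 2) := by rw [S.bias_eq x hx]
      _ ≤ c₁ / c₂ * τ * (ω x * (p₀ x ^ 2 / 16)) := by gcongr
      _ = _ := by field_simp
  exact le_of_mul_le_mul_right key (by positivity)

lemma integral_variance_le (S : BulkSetup K p₀ h ω B M κ e α L r τ I n c₁ c₂ c₃)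
    {p : Space d → ℝ} (hpm : Measurable p) (hp0 : ∀ x, 0 ≤ p x) (hpb : ∃ V, ∀ x, p x ≤ V) :
    ∫ x in B, ω x ^ 2 / h x ^ d * (2 * p x + p₀ x) ^ 2 ≤
      (18 * c₁ * c₃ + c₁ / (2 * c₂)) * (τ * (τ + sqDist ω p p₀ B)) * n ^ 2 := by
  have hn := S.n_pos
  have hτ := S.τ_pos
  have hI := S.I_pos
  have h1 := S.c₁_pos
  have h2 := S.c₂_pos
  have h5 := S.c₃_pos
  have hD := S.sqDist_nonneg p
  have hΔ : IntegrableOn (fun x => ω x * (p x - p₀ x) ^ 2) B :=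
    S.integrableOn_weight_mul_sq (hpm.sub S.meas_p₀) (S.bdd_sub hp0 hpb)
  have hpt : ∀ x ∈ B, ω x ^ 2 / h x ^ d * (2 * p x + p₀ x) ^ 2 ≤
      n ^ 2 * (18 * c₁ * (τ ^ 2 / I)) * p₀ x ^ r +
        n ^ 2 * (c₁ / (2 * c₂) * τ) * (ω x * (p x - p₀ x) ^ 2) := by
    intro x hx
    have hω := S.ω_pos x hx
    have hh := S.h_pos hx
    have e1 : ω x ^ 2 / h x ^ d * p₀ x ^ 2 = n ^ 2 * (c₁ * (τ ^ 2 / I) * p₀ x ^ r) := by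
      rw [← S.variance_eq x hx]; field_simp
    have e2 : ω x / h x ^ d ≤ n ^ 2 * (c₁ / (16 * c₂) * τ) := by
      have := S.weight_div_le hx
      rw [div_le_iff₀ (by positivity)] at this
      linarith
    have e3 : (2 * p x + p₀ x) ^ 2 ≤ 8 * (p x - p₀ x) ^ 2 + 18 * p₀ x ^ 2 := by
      nlinarith [sq_nonneg (2 * (p x - p₀ x) - 3 * p₀ x)]
    calc ω x ^ 2 / h x ^ d * (2 * p x + p₀ x) ^ 2
        ≤ ω x ^ 2 / h x ^ d * (8 * (p x - p₀ x) ^ 2 + 18 * p₀ x ^ 2) := by gcongr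
      _ = 18 * (ω x ^ 2 / h x ^ d * p₀ x ^ 2) +
            (ω x / h x ^ d) * (8 * (ω x * (p x - p₀ x) ^ 2)) := by ring
      _ ≤ 18 * (n ^ 2 * (c₁ * (τ ^ 2 / I) * p₀ x ^ r)) +
            (n ^ 2 * (c₁ / (16 * c₂) * τ)) * (8 * (ω x * (p x - p₀ x) ^ 2)) := by
          rw [e1]; gcongr
      _ = _ := by field_simp; ring
  calc ∫ x in B, ω x ^ 2 / h x ^ d * (2 * p x + p₀ x) ^ 2
      ≤ ∫ x in B, (n ^ 2 * (18 * c₁ * (τ ^ 2 / I)) * p₀ x ^ r +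
        n ^ 2 * (c₁ / (2 * c₂) * τ) * (ω x * (p x - p₀ x) ^ 2)) := by
        refine integral_mono_of_nonneg ?_
          ((S.integrableOn_rpow.const_mul _).add (hΔ.const_mul _)) ?_
        · filter_upwards [ae_restrict_mem S.meas_B] with x hx
          have := S.h_pos hx
          simp only [Pi.zero_apply]
          positivity
        · filter_upwards [ae_restrict_mem S.meas_B] with x hx using hpt x hx
    _ = n ^ 2 * (18 * c₁ * (τ ^ 2 / I)) * (∫ x in B, p₀ x ^ r) +
        n ^ 2 * (c₁ / (2 * c₂) * τ) * sqDist ω p p₀ B := by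
        rw [integral_add (S.integrableOn_rpow.const_mul _) (hΔ.const_mul _), integral_const_mul,
          integral_const_mul]
        rfl
    _ ≤ n ^ 2 * (18 * c₁ * (τ ^ 2 / I)) * (c₃ * I) +
        n ^ 2 * (c₁ / (2 * c₂) * τ) * sqDist ω p p₀ B := by
        gcongr
        exact S.integral_rpow_le
    _ = n ^ 2 * (18 * c₁ * c₃ * τ ^ 2 + c₁ / (2 * c₂) * (τ * sqDist ω p p₀ B)) := by
        field_simp
    _ ≤ n ^ 2 * ((18 * c₁ * c₃ + c₁ / (2 * c₂)) * (τ * (τ + sqDist ω p p₀ B))) := by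
        have i1 : 0 ≤ 18 * c₁ * c₃ * (τ * sqDist ω p p₀ B) := by positivity
        have i2 : 0 ≤ c₁ / (2 * c₂) * τ ^ 2 := by positivity
        have i3 : (18 * c₁ * c₃ + c₁ / (2 * c₂)) * (τ * (τ + sqDist ω p p₀ B)) =
          18 * c₁ * c₃ * τ ^ 2 + c₁ / (2 * c₂) * (τ * sqDist ω p p₀ B) +
          18 * c₁ * c₃ * (τ * sqDist ω p p₀ B) + c₁ / (2 * c₂) * τ ^ 2 := by ring
        refine mul_le_mul_of_nonneg_left ?_ (by positivity)
        rw [i3]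
        linarith
    _ = _ := by ring

/-- Two functions that differ by at most the bias have comparable weighted `L²` norms. -/
lemma integral_weight_sq_le (S : BulkSetup K p₀ h ω B M κ e α L r τ I n c₁ c₂ c₃)
    {f g : Space d → ℝ} (hf : IntegrableOn (fun x => ω x * f x ^ 2) B) {b : ℝ}
    (hfg : ∀ x ∈ B, |g x - f x| ≤ b * (L * h x ^ α)) :
    ∫ x in B, ω x * g x ^ 2 ≤ 2 * (∫ x in B, ω x * f x ^ 2) + 2 * b ^ 2 * c₂ * c₃ * τ := by
  have hτ := S.τ_pos
  have hI := S.I_pos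
  have h2 := S.c₂_pos
  have hpt : ∀ x ∈ B, ω x * g x ^ 2 ≤
      2 * (ω x * f x ^ 2) + 2 * b ^ 2 * (c₂ * (τ / I)) * p₀ x ^ r := by
    intro x hx
    have hω := S.ω_pos x hx
    have e1 : (g x - f x) ^ 2 ≤ (b * (L * h x ^ α)) ^ 2 :=
      sq_le_sq' (by linarith [(abs_le.1 (hfg x hx)).1]) (le_of_abs_le (hfg x hx))
    have e2 : g x ^ 2 ≤ 2 * f x ^ 2 + 2 * (b * (L * h x ^ α)) ^ 2 := by
      nlinarith [sq_nonneg (g x - 2 * f x)]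
    calc ω x * g x ^ 2 ≤ ω x * (2 * f x ^ 2 + 2 * (b * (L * h x ^ α)) ^ 2) := by gcongr
      _ = 2 * (ω x * f x ^ 2) + 2 * b ^ 2 * (ω x * (L * h x ^ α) ^ 2) := by ring
      _ = _ := by rw [S.bias_eq x hx]; ring
  calc ∫ x in B, ω x * g x ^ 2
      ≤ ∫ x in B, (2 * (ω x * f x ^ 2) + 2 * b ^ 2 * (c₂ * (τ / I)) * p₀ x ^ r) := by
        refine integral_mono_of_nonneg (Filter.Eventually.of_forall fun x =>
          mul_nonneg (S.ω_nonneg x) (sq_nonneg _))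
          ((hf.const_mul _).add (S.integrableOn_rpow.const_mul _)) ?_
        filter_upwards [ae_restrict_mem S.meas_B] with x hx using hpt x hx
    _ = 2 * (∫ x in B, ω x * f x ^ 2) + 2 * b ^ 2 * (c₂ * (τ / I)) * ∫ x in B, p₀ x ^ r := by
        rw [integral_add (hf.const_mul _) (S.integrableOn_rpow.const_mul _), integral_const_mul,
          integral_const_mul]
    _ ≤ 2 * (∫ x in B, ω x * f x ^ 2) + 2 * b ^ 2 * (c₂ * (τ / I)) * (c₃ * I) := by
        gcongr
        exact S.integral_rpow_le
    _ = _ := by field_simp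

/-- Mean and mean square deviation of the test statistic for observations with density `p`. -/
lemma moments (S : BulkSetup K p₀ h ω B M κ e α L r τ I n c₁ c₂ c₃) {p : Space d → ℝ}
    (hpm : Measurable p) (hp0 : ∀ x, 0 ≤ p x) (hpb : ∃ V, ∀ x, p x ≤ V)
    [IsProbabilityMeasure (volume.withDensity fun x => ENNReal.ofReal (p x))]
    (hloc : ∀ x ∈ B, ∀ u, ‖x - u‖ ≤ h x / 2 → p u ≤ 2 * p x + p₀ x) {b : ℝ}
    (hbias : ∀ x ∈ B, |p x - ∫ y, scaledKernel K (h x) (x - y) * p y| ≤ b * (L * h x ^ α))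
    {k : ℕ} (hk : 0 < k) (hnk : n = 2 * k) :
    BddMeas (fun X : Fin (2 * k) → Space d => ∫ x in B, ω x *
        (kernelEstimator K (firstHalf k) (h x) X x - p₀ x) *
        (kernelEstimator K (secondHalf k) (h x) X x - p₀ x)) ∧
    ∃ A : ℝ, 0 ≤ A ∧ A ≤ 2 * sqDist ω p p₀ B + momentConst d M e c₁ c₂ c₃ b * τ ∧
      sqDist ω p p₀ B ≤ 2 * A + momentConst d M e c₁ c₂ c₃ b * τ ∧
      ∫ X, ((∫ x in B, ω x * (kernelEstimator K (firstHalf k) (h x) X x - p₀ x) *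
          (kernelEstimator K (secondHalf k) (h x) X x - p₀ x)) - A) ^ 2 ∂(sampleLaw (2 * k) p) ≤
        momentConst d M e c₁ c₂ c₃ b * (A * √(τ * (τ + sqDist ω p p₀ B)) +
          τ * (τ + sqDist ω p p₀ B)) := by
  have := S.isFiniteMeasure
  set P := volume.withDensity fun x => ENNReal.ofReal (p x) with hP
  have hτ := S.τ_pos
  have hn := S.n_pos
  have h1 := S.c₁_pos
  have h2 := S.c₂_pos
  have h5 := S.c₃_pos
  have hM := S.M_nonneg
  have hV := ballVol_nonneg d
  have hS0 := S.sqDist_nonneg p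
  have hk' : (0 : ℝ) < k := by exact_mod_cast hk
  set z := locKernel K h ω B with hz_def
  have hz : BddMeas (fun q : Space d × Space d => z q.1 q.2) := S.bddMeas_locKernel
  set q : Space d → ℝ := fun x => B.indicator (fun x => √(ω x)) x * B.indicator p₀ x with hq_def
  have hq : BddMeas q := by
    refine S.bddMeas_sqrt_weight.mul (S.bddMeas_indicator S.meas_p₀ ?_)
    obtain ⟨V, hV⟩ := S.p₀_upper
    exact ⟨V, fun x hx => by rw [abs_of_pos (S.p₀_pos hx)]; exact hV x hx⟩
  have hTeq : ∀ X : Fin (2 * k) → Space d, (∫ x in B, ω x *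
      (kernelEstimator K (firstHalf k) (h x) X x - p₀ x) *
      (kernelEstimator K (secondHalf k) (h x) X x - p₀ x)) =
      splitStat (volume.restrict B) k (firstHalf k) (secondHalf k) z q X := by
    intro X
    refine setIntegral_congr_fun S.meas_B fun x hx => ?_
    simp only [hz_def, hq_def, locKernel, Set.indicator_of_mem hx, kernelEstimator,
      ← Finset.mul_sum]
    have hs := Real.mul_self_sqrt (S.ω_nonneg x)
    nth_rewrite 1 [← hs]
    ring
  have hm : ∀ x ∈ B, (∫ u, z x u ∂P) = √(ω x) * ∫ y, scaledKernel K (h x) (x - y) * p y := by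
    intro x hx
    rw [hP, integral_withDensity_eq_integral_toReal_smul hpm.ennreal_ofReal (by simp),
      ← integral_const_mul]
    refine integral_congr_ae (Filter.Eventually.of_forall fun u => ?_)
    simp only [hz_def, locKernel, Set.indicator_of_mem hx, ENNReal.toReal_ofReal (hp0 u),
      smul_eq_mul]
    ring
  set a : Space d → ℝ := fun x => (∫ y, scaledKernel K (h x) (x - y) * p y) - p₀ x with ha_def
  have hmq : ∀ x ∈ B, ((∫ u, z x u ∂P) - q x) ^ 2 = ω x * a x ^ 2 := by
    intro x hx
    rw [hm x hx]
    simp only [hq_def, Set.indicator_of_mem hx, ha_def]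
    rw [← mul_sub, mul_pow, Real.sq_sqrt (S.ω_nonneg x)]
  have hA : ∫ x in B, ((∫ u, z x u ∂P) - q x) ^ 2 = ∫ x in B, ω x * a x ^ 2 :=
    setIntegral_congr_fun S.meas_B hmq
  have haI : IntegrableOn (fun x => ω x * a x ^ 2) B := by
    have h3 : IntegrableOn (fun x => ((∫ u, z x u ∂P) - q x) ^ 2) B :=
      ((hz.integral_right P).sub hq).sq.integrable _
    exact h3.congr_fun hmq S.meas_B
  have hΔI : IntegrableOn (fun x => ω x * (p x - p₀ x) ^ 2) B :=
    S.integrableOn_weight_mul_sq (hpm.sub S.meas_p₀) (S.bdd_sub hp0 hpb)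
  set A := ∫ x in B, ω x * a x ^ 2 with hA_def
  have hA0 : 0 ≤ A := integral_nonneg fun x => mul_nonneg (S.ω_nonneg x) (sq_nonneg _)
  set G := (M ^ 2 * ((8 : ℝ) ^ e) ^ d * ballVol d * (M * ballVol d) ^ 2) *
    (18 * c₁ * c₃ + c₁ / (2 * c₂)) with hG
  have hG0 : 0 ≤ G := by positivity
  have hC : momentConst d M e c₁ c₂ c₃ b = 2 * b ^ 2 * c₂ * c₃ + 1 + 24 * (G + 1) := rfl
  set C := momentConst d M e c₁ c₂ c₃ b with hC_def
  have hbc : 0 ≤ 2 * b ^ 2 * c₂ * c₃ := by positivity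
  set V := τ * (τ + sqDist ω p p₀ B) with hV_def
  have hV0 : 0 ≤ V := by positivity
  simp only [hTeq]
  refine ⟨BddMeas.splitStat k _ _ hz hq, A, hA0, ?_, ?_, ?_⟩
  · refine (S.integral_weight_sq_le (f := fun x => p x - p₀ x) (g := a) (b := b) hΔI
      fun x hx => ?_).trans ?_
    · refine le_trans (le_of_eq ?_) (hbias x hx)
      rw [abs_sub_comm]
      simp only [ha_def]
      congr 1
      ring
    · change 2 * sqDist ω p p₀ B + 2 * b ^ 2 * c₂ * c₃ * τ ≤ _
      rw [hC]
      nlinarith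
  · refine (S.integral_weight_sq_le (g := fun x => p x - p₀ x) (b := b) haI
      fun x hx => ?_).trans ?_
    · refine le_trans (le_of_eq ?_) (hbias x hx)
      simp only [ha_def]
      congr 1
      ring
    · rw [hC]
      nlinarith
  · set W := ∫ u, ∫ v, (∫ x in B, z x u * z x v) ^ 2 ∂P ∂P with hW
    have hcard := card_firstHalf k
    have hcard' := card_secondHalf k
    have hdisj : Disjoint (firstHalf k) (secondHalf k) := by
      refine Finset.disjoint_left.2 fun i hi hi' => ?_
      simp only [firstHalf, secondHalf, Finset.mem_filter] at hi hi'
      omega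
    have hW0 : 0 ≤ W := integral_nonneg fun u => integral_nonneg fun v => sq_nonneg _
    have hWV : W / k ^ 2 ≤ 4 * (G + 1) * V := by
      have i1 := S.integral_sq_gram_locKernel_le hpm hp0 (b := fun x => 2 * p x + p₀ x)
        ((hpm.const_mul 2).add S.meas_p₀)
        (fun x hx => by have := hp0 x; have := S.p₀_pos hx; positivity)
        (by
          obtain ⟨v, hv⟩ := hpb
          obtain ⟨v₀, hv₀⟩ := S.p₀_upper
          exact ⟨2 * v + v₀, fun x hx => by linarith [hv x, hv₀ x hx]⟩) hloc
      have i2 : W ≤ G * V * n ^ 2 := by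
        refine i1.trans ?_
        calc _ ≤ (M ^ 2 * ((8 : ℝ) ^ e) ^ d * ballVol d * (M * ballVol d) ^ 2) *
              ((18 * c₁ * c₃ + c₁ / (2 * c₂)) * V * n ^ 2) :=
              mul_le_mul_of_nonneg_left (S.integral_variance_le hpm hp0 hpb) (by positivity)
          _ = _ := by rw [hG]; ring
      rw [div_le_iff₀ (by positivity)]
      rw [hnk] at i2
      have : 0 ≤ V * (k : ℝ) ^ 2 := by positivity
      nlinarith
    have key := integral_sq_splitStat_sub_le (P := P) hk hdisj hcard hcard' hz hq
      (μ := volume.restrict B)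
    rw [hA] at key
    refine key.trans ?_
    have hsq : √(W / k ^ 2) ≤ 2 * (G + 1) * √V := by
      have : √(W / k ^ 2) ≤ √((2 * (G + 1)) ^ 2 * V) := by
        refine Real.sqrt_le_sqrt (hWV.trans ?_)
        nlinarith [mul_nonneg (mul_nonneg hG0 hV0) hG0, mul_nonneg hG0 hV0]
      rwa [Real.sqrt_mul (by positivity), Real.sqrt_sq (by positivity)] at this
    calc 6 * (A * √(W / k ^ 2)) + 3 * (W / k ^ 2)
        ≤ 6 * (A * (2 * (G + 1) * √V)) + 3 * (4 * (G + 1) * V) := by gcongr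
      _ = 12 * (G + 1) * (A * √V + V) := by ring
      _ ≤ C * (A * √V + V) := by
          have : 0 ≤ A * √V + V := by positivity
          refine mul_le_mul_of_nonneg_right ?_ this
          rw [hC]
          linarith

end BulkSetup

/-- Hölder's inequality in the form `∫_B |p - p₀|^t ≤ (∫_B ω (p - p₀)²)^{t/2} (∫_B p₀^r)^{1-t/2}`,
with upper bounds in place of the two integrals. It uses that `ω^{t/2} p₀^{r(1-t/2)} = 1`. -/
lemma BulkSetup.integral_rpow_abs_sub_le {d : ℕ} {K p₀ h ω : Space d → ℝ} {B : Set (Space d)}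
    {M κ e α L r τ I n c₁ c₂ c₃ : ℝ} (S : BulkSetup K p₀ h ω B M κ e α L r τ I n c₁ c₂ c₃)
    {t : ℝ} (ht0 : 0 < t) (ht : t ≤ 2)
    (hω : ∀ x ∈ B, ω x ^ (t / 2) * (p₀ x ^ r) ^ (1 - t / 2) = 1) {p : Space d → ℝ}
    (hpm : Measurable p) (hp0 : ∀ x, 0 ≤ p x) (hpb : ∃ V, ∀ x, p x ≤ V) {s : ℝ} (hs : 0 < s)
    (hS : sqDist ω p p₀ B ≤ s) :
    ∫ x in B, |p x - p₀ x| ^ t ≤ s ^ (t / 2) * (c₃ * I) ^ (1 - t / 2) := by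
  have hI := S.I_pos
  have h5 := S.c₃_pos
  set R := c₃ * I with hR
  have hR0 : 0 < R := by positivity
  have ht2 : 0 ≤ 1 - t / 2 := by linarith
  have hΔ : IntegrableOn (fun x => ω x * (p x - p₀ x) ^ 2) B :=
    S.integrableOn_weight_mul_sq (hpm.sub S.meas_p₀) (S.bdd_sub hp0 hpb)
  have hpt : ∀ x ∈ B, |p x - p₀ x| ^ t ≤ s ^ (t / 2) * R ^ (1 - t / 2) *
      (t / 2 / s * (ω x * (p x - p₀ x) ^ 2) + (1 - t / 2) / R * p₀ x ^ r) := by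
    intro x hx
    have hωx := S.ω_pos x hx
    have hpx := S.p₀_pos hx
    have e1 : ((p x - p₀ x) ^ 2) ^ (t / 2) = |p x - p₀ x| ^ t := by
      rw [← sq_abs, ← Real.rpow_natCast, ← Real.rpow_mul (abs_nonneg _)]
      congr 1
      push_cast
      ring
    have e2 : |p x - p₀ x| ^ t =
        (ω x * (p x - p₀ x) ^ 2) ^ (t / 2) * (p₀ x ^ r) ^ (1 - t / 2) := by
      rw [Real.mul_rpow hωx.le (sq_nonneg _), e1, mul_right_comm, hω x hx, one_mul]
    have e3 := Real.geom_mean_le_arith_mean2_weighted (by positivity : 0 ≤ t / 2) ht2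
      (by positivity : 0 ≤ ω x * (p x - p₀ x) ^ 2 / s) (by positivity : 0 ≤ p₀ x ^ r / R) (by ring)
    rw [Real.div_rpow (by positivity) hs.le, Real.div_rpow (by positivity) hR0.le,
      div_mul_div_comm, ← e2, div_le_iff₀ (by positivity)] at e3
    refine e3.trans (le_of_eq ?_)
    ring
  calc ∫ x in B, |p x - p₀ x| ^ t
      ≤ ∫ x in B, s ^ (t / 2) * R ^ (1 - t / 2) *
          (t / 2 / s * (ω x * (p x - p₀ x) ^ 2) + (1 - t / 2) / R * p₀ x ^ r) := by
        refine integral_mono_of_nonneg (Filter.Eventually.of_forall fun x =>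
          Real.rpow_nonneg (abs_nonneg _) _)
          (((hΔ.const_mul _).add (S.integrableOn_rpow.const_mul _)).const_mul _) ?_
        filter_upwards [ae_restrict_mem S.meas_B] with x hx using hpt x hx
    _ = s ^ (t / 2) * R ^ (1 - t / 2) *
          (t / 2 / s * sqDist ω p p₀ B + (1 - t / 2) / R * ∫ x in B, p₀ x ^ r) := by
        rw [integral_const_mul, integral_add (hΔ.const_mul _) (S.integrableOn_rpow.const_mul _),
          integral_const_mul, integral_const_mul]
        rfl
    _ ≤ s ^ (t / 2) * R ^ (1 - t / 2) * (t / 2 / s * s + (1 - t / 2) / R * R) := by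
        have := S.integral_rpow_le
        gcongr
    _ = _ := by
        field_simp
        ring

/-- The moment bounds hold for all the densities of the enlarged class. -/
lemma BulkSetup.moments_of_mem_densityClass {d : ℕ} {K p₀ h ω : Space d → ℝ} {B : Set (Space d)}
    {M κ e α L r τ I n c₁ c₂ c₃ : ℝ} (S : BulkSetup K p₀ h ω B M κ e α L r τ I n c₁ c₂ c₃)
    {CK : ℝ} (hCK : ∀ L : ℝ, 0 < L → ∀ f ∈ holderClass d α L, ∀ h : ℝ, 0 < h → ∀ x,
      |f x - ∫ y, scaledKernel K h (x - y) * f y| ≤ CK * L * h ^ α)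
    {δ cStar : ℝ} (hδ0 : 0 ≤ δ) (hδ1 : δ ≤ 1) (hc1 : cStar < 1 / 2)
    {p : Space d → ℝ} (hp : p ∈ densityClass d α ((1 + δ) * L) ((1 + δ) * cStar))
    {k : ℕ} (hk : 0 < k) (hnk : n = 2 * k) :
    BddMeas (fun X : Fin (2 * k) → Space d => ∫ x in B, ω x *
        (kernelEstimator K (firstHalf k) (h x) X x - p₀ x) *
        (kernelEstimator K (secondHalf k) (h x) X x - p₀ x)) ∧
    ∃ A : ℝ, 0 ≤ A ∧ A ≤ 2 * sqDist ω p p₀ B + momentConst d M e c₁ c₂ c₃ (2 * |CK|) * τ ∧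
      sqDist ω p p₀ B ≤ 2 * A + momentConst d M e c₁ c₂ c₃ (2 * |CK|) * τ ∧
      ∫ X, ((∫ x in B, ω x * (kernelEstimator K (firstHalf k) (h x) X x - p₀ x) *
          (kernelEstimator K (secondHalf k) (h x) X x - p₀ x)) - A) ^ 2 ∂(sampleLaw (2 * k) p) ≤
        momentConst d M e c₁ c₂ c₃ (2 * |CK|) * (A * √(τ * (τ + sqDist ω p p₀ B)) +
          τ * (τ + sqDist ω p p₀ B)) := by
  have hα := S.α_pos
  have hL := S.L_pos
  have hc : (1 + δ) * cStar < 1 := by nlinarith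
  have := isProbabilityMeasure_of_mem_densityClass hp
  refine S.moments (continuous_of_mem_holderClass hα hp.1).measurable hp.2.1
    (exists_bound_of_mem_densityClass hα (by positivity) hc hp) (fun x hx u hu => ?_)
    (fun x hx => ?_) hk hnk
  · have h1 := (abs_le.1 (hp.2.2.2.2 x u)).1
    have hb := S.h_pos hx
    have h2 : ‖x - u‖ ^ α ≤ h x ^ α := Real.rpow_le_rpow (norm_nonneg _) (by linarith) hα.le
    have h3 := S.bias_small x hx
    have h4 := hp.2.1 x
    have h5 := S.p₀_pos hx
    have h6 : (1 + δ) * cStar * p x ≤ 1 * p x := mul_le_mul_of_nonneg_right hc.le h4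
    have h7 : (1 + δ) * L * ‖x - u‖ ^ α ≤ 2 * (L * h x ^ α) := by
      rw [mul_assoc]
      gcongr
      linarith
    linarith
  · have hb := S.h_pos hx
    refine (hCK _ (by positivity) p hp.1 _ hb x).trans ?_
    have h1 : 0 ≤ L * h x ^ α := by positivity
    calc CK * ((1 + δ) * L) * h x ^ α = CK * (1 + δ) * (L * h x ^ α) := by ring
      _ ≤ |CK| * 2 * (L * h x ^ α) := by
          refine mul_le_mul_of_nonneg_right ?_ h1
          exact mul_le_mul (le_abs_self _) (by linarith) (by linarith) (abs_nonneg _)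
      _ = _ := by ring

/-- A density at `L^t` distance a large multiple of `(τ^{t/2} ℐ^{1-t/2})^{1/t}` has a weighted
squared distance that is a large multiple of `τ`. -/
lemma BulkSetup.le_sqDist_of_separated {d : ℕ} {K p₀ h ω : Space d → ℝ} {B : Set (Space d)}
    {M κ e α L r τ I n c₁ c₂ c₃ : ℝ} (S : BulkSetup K p₀ h ω B M κ e α L r τ I n c₁ c₂ c₃)
    {t : ℝ} (ht1 : 1 ≤ t) (ht : t ≤ 2)
    (hω : ∀ x ∈ B, ω x ^ (t / 2) * (p₀ x ^ r) ^ (1 - t / 2) = 1) {p : Space d → ℝ}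
    (hpm : Measurable p) (hp0 : ∀ x, 0 ≤ p x) (hpb : ∃ V, ∀ x, p x ≤ V) {N ρ : ℝ} (hN : 1 ≤ N)
    (hρ : 0 ≤ ρ) (hid : ρ ^ t = τ ^ (t / 2) * I ^ (1 - t / 2))
    (hsep : ((N * (1 + c₃) + 1) * ρ) ^ t ≤ ∫ x in B, |p x - p₀ x| ^ t) :
    N * τ ≤ sqDist ω p p₀ B := by
  have hτ := S.τ_pos
  have hI := S.I_pos
  have h3 := S.c₃_pos
  by_contra! hcon
  have hall := hsep.trans
    (S.integral_rpow_abs_sub_le (by linarith) ht hω hpm hp0 hpb (by positivity) hcon.le)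
  rw [Real.mul_rpow (by positivity) hρ, hid, Real.mul_rpow (by positivity) hτ.le,
    Real.mul_rpow h3.le hI.le, mul_mul_mul_comm] at hall
  have hcmp := le_of_mul_le_mul_right hall (by positivity)
  have g1 : N ^ (t / 2) ≤ N := Real.rpow_le_self_of_one_le hN (by linarith)
  have g2 : c₃ ^ (1 - t / 2) ≤ 1 + c₃ := by
    calc c₃ ^ (1 - t / 2) ≤ (1 + c₃) ^ (1 - t / 2) :=
          Real.rpow_le_rpow h3.le (by linarith) (by linarith)
      _ ≤ 1 + c₃ := Real.rpow_le_self_of_one_le (by linarith) (by linarith)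
  have hN1 : 0 ≤ N * (1 + c₃) := by positivity
  have g3 : N * (1 + c₃) + 1 ≤ (N * (1 + c₃) + 1) ^ t :=
    Real.self_le_rpow_of_one_le (by linarith) ht1
  have g4 : N ^ (t / 2) * c₃ ^ (1 - t / 2) ≤ N * (1 + c₃) :=
    mul_le_mul g1 g2 (by positivity) (by linarith)
  linarith

/-! ### The test -/

lemma measure_abs_sub_ge_le {Ω : Type*} [MeasurableSpace Ω] {Q : Measure Ω}
    [IsProbabilityMeasure Q] {Y : Ω → ℝ} (hY : BddMeas Y) {A s V : ℝ} (hs : 0 < s)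
    (hV : ∫ X, (Y X - A) ^ 2 ∂Q ≤ V) :
    Q {X | s ≤ |Y X - A|} ≤ ENNReal.ofReal (V / s ^ 2) := by
  have h1 := mul_meas_ge_le_integral_of_nonneg (μ := Q) (f := fun X => (Y X - A) ^ 2)
    (Filter.Eventually.of_forall fun X => sq_nonneg _)
    ((hY.sub (BddMeas.const A)).sq.integrable Q) (s ^ 2)
  have h2 : {X | s ≤ |Y X - A|} = {X | s ^ 2 ≤ (Y X - A) ^ 2} := by
    ext X
    simp only [Set.mem_ofPred_eq]
    rw [← sq_abs (Y X - A), pow_le_pow_iff_left₀ hs.le (abs_nonneg _) two_ne_zero]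
  rw [h2, ← ENNReal.ofReal_toReal (measure_ne_top Q _)]
  refine ENNReal.ofReal_le_ofReal ?_
  rw [le_div_iff₀ (by positivity)]
  rw [Measure.real] at h1
  linarith

/-- The error of the second kind: the squared signal `σ` dominates threshold and deviation. -/
lemma alternative_bound {C Q N η τ σ A : ℝ} (hC : 0 < C) (hQ : 0 < Q) (hη : 0 < η) (hτ : 0 < τ)
    (hN2 : 2 ≤ N) (hNQ : 4 * (C + Q) ≤ N) (hNη : 2 * (64 * C * (3 + C) / η) ^ 2 ≤ N)
    (hσ : N * τ ≤ σ) (hA1 : A ≤ 2 * σ + C * τ) (hA2 : σ ≤ 2 * A + C * τ) :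
    0 < A - Q * τ ∧
      C * (A * √(τ * (τ + σ)) + τ * (τ + σ)) / (A - Q * τ) ^ 2 ≤ η / 4 := by
  have hN : 0 < N := by linarith
  have hσ0 : 0 < σ := by nlinarith
  have hτσ : τ ≤ σ / N := by rw [le_div_iff₀ hN]; linarith
  have h1 : (C + Q) * τ ≤ σ / 4 := by nlinarith
  have h2 : σ / 4 ≤ A - Q * τ := by nlinarith
  refine ⟨by linarith, ?_⟩
  have hτσ' : τ ≤ σ := by nlinarith
  have hA : A ≤ (2 + C) * σ := by nlinarith
  set ε := √(2 / N) with hε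
  have hε0 : 0 ≤ ε := Real.sqrt_nonneg _
  have hε2 : ε ^ 2 = 2 / N := Real.sq_sqrt (by positivity)
  have hε1 : ε ≤ 1 := by
    rw [hε, Real.sqrt_le_left zero_le_one, one_pow, div_le_one hN]
    exact hN2
  have hV : τ * (τ + σ) ≤ ε ^ 2 * σ ^ 2 := by
    calc τ * (τ + σ) ≤ σ / N * (σ + σ) := by gcongr
      _ = _ := by rw [hε2]; field_simp; ring
  have hsV : √(τ * (τ + σ)) ≤ ε * σ := by
    rw [Real.sqrt_le_left (by positivity)]
    linarith [mul_pow ε σ 2]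
  have hA0 : 0 ≤ A := by nlinarith
  have hnum : C * (A * √(τ * (τ + σ)) + τ * (τ + σ)) ≤ C * (3 + C) * ε * σ ^ 2 := by
    calc C * (A * √(τ * (τ + σ)) + τ * (τ + σ))
        ≤ C * ((2 + C) * σ * (ε * σ) + ε ^ 2 * σ ^ 2) := by gcongr
      _ ≤ C * ((2 + C) * σ * (ε * σ) + ε * σ ^ 2) := by
          have : ε ^ 2 ≤ ε := by nlinarith
          gcongr
      _ = _ := by ring
  have hεη : 64 * C * (3 + C) / η * ε ≤ 1 := by
    have h3 : (64 * C * (3 + C) / η * ε) ^ 2 ≤ 1 := by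
      rw [mul_pow, hε2, ← mul_div_assoc, div_le_one hN]
      linarith
    exact (sq_le_one_iff₀ (by positivity)).1 h3
  have hden : σ ^ 2 / 16 ≤ (A - Q * τ) ^ 2 := by nlinarith
  rw [div_le_iff₀ (by nlinarith)]
  have h4 : C * (3 + C) * ε ≤ η / 64 := by
    have : 64 * C * (3 + C) / η * ε = 64 * (C * (3 + C) * ε) / η := by ring
    rw [this, div_le_one hη] at hεη
    linarith
  calc _ ≤ C * (3 + C) * ε * σ ^ 2 := hnum
    _ ≤ η / 64 * σ ^ 2 := by gcongr
    _ = η / 4 * (σ ^ 2 / 16) := by ring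
    _ ≤ _ := by gcongr

/-- The error of the first kind: the threshold dominates mean and deviation. -/
lemma null_bound {C Q η τ A : ℝ} (hC : 0 < C) (hη : 0 < η) (hτ : 0 < τ)
    (hQ : C + 1 + 4 * C * (C + 1) / η ≤ Q) (hA : A ≤ C * τ) :
    0 < (Q - C) * τ ∧ C * (A * τ + τ * τ) / ((Q - C) * τ) ^ 2 ≤ η / 4 := by
  have hX : 0 < 4 * C * (C + 1) / η := by positivity
  have hQC : 1 + 4 * C * (C + 1) / η ≤ Q - C := by linarith
  have hs : 0 < (Q - C) * τ := mul_pos (by linarith) hτ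
  refine ⟨hs, ?_⟩
  rw [div_le_iff₀ (by positivity)]
  have h1 : A * τ + τ * τ ≤ (C + 1) * τ ^ 2 := by
    have := mul_le_mul_of_nonneg_right hA hτ.le
    linarith [pow_two τ, mul_assoc C τ τ]
  have h2 : 4 * C * (C + 1) / η ≤ (Q - C) ^ 2 := by
    calc 4 * C * (C + 1) / η ≤ Q - C := by linarith
      _ ≤ (Q - C) ^ 2 := le_self_pow₀ (by linarith) two_ne_zero
  rw [div_le_iff₀ hη] at h2
  calc C * (A * τ + τ * τ) ≤ C * ((C + 1) * τ ^ 2) := by gcongr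
    _ = 4 * C * (C + 1) / 4 * τ ^ 2 := by ring
    _ ≤ (Q - C) ^ 2 * η / 4 * τ ^ 2 := by gcongr
    _ = _ := by ring

section Setup

variable {d : ℕ} {n : ℕ} {α t L cStar cAux cB CBT : ℝ} {K p₀ : Space d → ℝ}

lemma cH_pos (hcB : 0 < cB) : 0 < cH d α t cB := by
  unfold cH; positivity

lemma bandwidth_eq (x : Space d) : bandwidth n α t L cAux cB p₀ x =
    cH d α t cB / ((n : ℝ) ^ 2 * L ^ 4 * bulkI n α t L cAux p₀) ^ (1 / (4 * α + d)) *
      p₀ x ^ (2 / ((4 - t) * α + d)) := by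
  unfold bandwidth hBulk; ring

lemma weight_rpow_mul_rpow {x : Space d} (hx : 0 < p₀ x) :
    weight α t p₀ x ^ (t / 2) * (p₀ x ^ rExp d α t) ^ (1 - t / 2) = 1 := by
  rw [weight, rExp, ← Real.rpow_mul hx.le, ← Real.rpow_mul hx.le, ← Real.rpow_add hx,
    div_mul_eq_mul_div, div_mul_eq_mul_div, ← add_div,
    show (2 * α * t - 4 * α) * (t / 2) + 2 * α * t * (1 - t / 2) = 0 by ring, zero_div,
    Real.rpow_zero]

/-- The cut-off and the bandwidth of the test are tuned so that its ingredients form a bulk setup,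
with the constants `c₁` and `c₂` depending only on `c_h`. Away from `ℐ = 0`, the cut-off is bounded below by a
positive number, which makes every function involved bounded on the bulk. -/
lemma bulkSetup_of_mem_densityClass (hα : 0 < α) (ht : t ≤ 2) (hd : 1 ≤ d)
    (hcB : 0 < cB) (hK : IsKernel α K) {M : ℝ} (hM : ∀ x, |K x| ≤ M) (hn : 0 < n) (hL : 0 < L)
    (hc : cStar ≤ 1 / 2) (hp₀ : p₀ ∈ densityClass d α L cStar)
    (hI : 0 < bulkI n α t L cAux p₀) {c₃ : ℝ} (hc₃ : 0 < c₃)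
    (hint : IntegrableOn (fun x => p₀ x ^ rExp d α t) (bulkTilde n α t L cAux cB CBT p₀))
    (hle : ∫ x in bulkTilde n α t L cAux cB CBT p₀, p₀ x ^ rExp d α t ≤
      c₃ * bulkI n α t L cAux p₀) :
    BulkSetup K p₀ (bandwidth n α t L cAux cB p₀) (weight α t p₀)
      (bulkTilde n α t L cAux cB CBT p₀) M
      (cH d α t cB / ((n : ℝ) ^ 2 * L ^ 4 * bulkI n α t L cAux p₀) ^ (1 / (4 * α + d)))
      (2 / ((4 - t) * α + d)) α L (rExp d α t) (sepScale d α L n (bulkI n α t L cAux p₀))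
      (bulkI n α t L cAux p₀) n (1 / cH d α t cB ^ d) ((cH d α t cB ^ α) ^ 2) c₃ := by
  have hcont := continuous_of_mem_holderClass hα hp₀.1
  have hcH := cH_pos (d := d) (α := α) (t := t) hcB
  have hn' : (0 : ℝ) < n := by exact_mod_cast hn
  have hD : 0 < (4 - t) * α + d := by
    have : 0 < (4 - t) * α := mul_pos (by linarith) hα
    positivity
  obtain ⟨V, hV⟩ := exists_bound_of_mem_densityClass hα hL.le (by linarith) hp₀
  have h0 := hp₀.2.1
  have hi := hp₀.2.2.1
  have hG := cutScale_pos (d := d) (α := α) hL hn' hI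
  have hlow : ∀ x ∈ bulkTilde n α t L cAux cB CBT p₀, _ ≤ p₀ x :=
    fun x hx => le_of_mem_bulkTilde h0 hx
  have hv : 0 < (cB * cutScale d α L n (bulkI n α t L cAux p₀)) ^
    (((4 - t) * α + d) / ((2 - t) * α + d)) / 2 := by positivity
  have hpos : ∀ x ∈ bulkTilde n α t L cAux cB CBT p₀, 0 < p₀ x := fun x hx =>
    hv.trans_le (hlow x hx)
  have hsmall : ∀ x ∈ bulkTilde n α t L cAux cB CBT p₀,
      L * bandwidth n α t L cAux cB p₀ x ^ α ≤ p₀ x / 4 := fun x hx =>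
    bandwidth_le_of_cut hα ht hd hL hn' hI (hpos x hx) hcB (by linarith [hlow x hx])
  have hbpos : ∀ x ∈ bulkTilde n α t L cAux cB CBT p₀, 0 < bandwidth n α t L cAux cB p₀ x :=
    fun x hx => by
      rw [bandwidth_eq]
      have := hpos x hx
      positivity
  refine
    { meas_K := hK.measurable
      bound_K := hM
      supp_K := hK.support
      meas_p₀ := hcont.measurable
      meas_B := measurableSet_bulkSet hcont.measurable _
      vol_B := ?_
      κ_pos := by positivity
      e_nonneg := by positivity
      h_eq := bandwidth_eq
      meas_ω := hcont.measurable.pow_const _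
      ω_nonneg := fun x => Real.rpow_nonneg (h0 x) _
      ω_bdd := ⟨_, fun x hx => Real.rpow_le_rpow_of_nonpos hv (hlow x hx) ?_⟩
      p₀_lower := ⟨_, hv, hlow⟩
      p₀_upper := ⟨V, fun x _ => hV x⟩
      comparable := ?_
      α_pos := hα
      L_pos := hL
      τ_pos := sepScale_pos hL hn' hI
      I_pos := hI
      n_pos := hn'
      c₁_pos := by positivity
      c₂_pos := by positivity
      c₃_pos := hc₃
      ω_pos := fun x hx => Real.rpow_pos_of_pos (hpos x hx) _
      bias_small := hsmall
      bias_eq := fun x hx => bias_identity hα ht hL hn' hI (hpos x hx) hcH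
      variance_eq := fun x hx => variance_identity hα ht hL hn' hI (hpos x hx) hcH
      integrableOn_rpow := hint
      integral_rpow_le := hle }
  · exact (lt_of_le_of_lt (measure_mono fun x hx => hlow x hx) (hi.measure_ge_lt_top hv)).ne
  · refine div_nonpos_of_nonpos_of_nonneg ?_ hD.le
    nlinarith
  · intro x hx u hu
    have hb := hbpos x hx
    have h1 := hp₀.2.2.2.2 x u
    have h2 : ‖x - u‖ ^ α ≤ bandwidth n α t L cAux cB p₀ x ^ α :=
      Real.rpow_le_rpow (norm_nonneg _) (by linarith) hα.le
    have h3 := hsmall x hx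
    have h4 := hpos x hx
    have h5 := abs_le.1 h1
    constructor <;> nlinarith [h5.1, h5.2]

end Setup

end BulkTest

end

open BulkTest in
theorem mainTheorem2 (d : ℕ) (hd : 1 ≤ d) (α t η : ℝ) (hα : 0 < α) (ht : t ∈ Set.Icc (1 : ℝ) 2)
    (hη : η ∈ Set.Ioo (0 : ℝ) 1) (K : Space d → ℝ) (hK : IsKernel α K)
    (cAux cB CBT : ℝ) (hcAux : 0 < cAux) (hcB : 0 < cB) (hCBT : 0 < CBT) :
    ∃ C₀ : ℝ, 1 < C₀ ∧ ∀ Ctn Cpsi : ℝ, C₀ ≤ Ctn → C₀ ≤ Cpsi →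
      ∃ Cb : ℝ, 0 < Cb ∧
        ∀ (L δ cStar : ℝ), 0 < L → δ ∈ Set.Ioo (0 : ℝ) 1 → cStar ∈ Set.Ioo (0 : ℝ) (1 / 2) →
        ∀ k : ℕ, 0 < k →
        ∀ p₀ ∈ densityClass d α L cStar, 0 < rhoBulk (2 * k) α t L cAux p₀ →
          sampleLaw (2 * k) p₀ {X | psiBulk α t L cAux cB CBT Ctn Cpsi K p₀ X = 1} +
            (⨆ p ∈ bulkAlternatives (2 * k) α t L δ cStar cAux cB CBT p₀
                (Cb * rhoBulk (2 * k) α t L cAux p₀),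
              sampleLaw (2 * k) p {X | psiBulk α t L cAux cB CBT Ctn Cpsi K p₀ X = 0}) ≤
          ENNReal.ofReal (η / 2) := by
  obtain ⟨ht1, ht2⟩ := ht
  obtain ⟨hη0, hη1⟩ := hη
  obtain ⟨M, hM⟩ := hK.bounded
  obtain ⟨CK, hCK⟩ := hK.order
  obtain ⟨c₃, hc₃, hbulk⟩ :=
    exists_setIntegral_bulkTilde_le (d := d) hα ht1 ht2 hd hcAux hcB hCBT
  have hcH := cH_pos (d := d) (α := α) (t := t) hcB
  have hM0 : 0 ≤ M := (abs_nonneg _).trans (hM 0)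
  have hV := ballVol_nonneg d
  set C := momentConst d M (2 / ((4 - t) * α + d)) (1 / cH d α t cB ^ d)
    ((cH d α t cB ^ α) ^ 2) c₃ (2 * |CK|) with hC_def
  have hC : 0 < C := by
    rw [hC_def]; unfold momentConst; positivity
  -- With a threshold this large, Chebyshev's inequality bounds the error under `p₀` by `η / 4`.
  refine ⟨C + 1 + 4 * C * (C + 1) / η, by
    have : 0 < 4 * C * (C + 1) / η := by positivity
    linarith, fun Ctn Cpsi hCtn hCpsi => ?_⟩
  have hfrac : 0 < 4 * C * (C + 1) / η := by positivity
  -- The threshold of the test is `Q τ`.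
  set Q := Cpsi * Ctn with hQ_def
  have hQ : C + 1 + 4 * C * (C + 1) / η ≤ Q := by nlinarith
  have hQ0 : 0 < Q := by linarith
  -- Alternatives whose weighted squared distance is at least `N τ` are detected.
  set N := 2 + 4 * (C + Q) + 2 * (64 * C * (3 + C) / η) ^ 2 with hN_def
  have hN0 : 0 < 2 * (64 * C * (3 + C) / η) ^ 2 := by positivity
  have hN : 2 ≤ N := by linarith
  refine ⟨N * (1 + c₃) + 1, by positivity, fun L δ cStar hL hδ hcStar k hk p₀ hp₀ hρ => ?_⟩
  obtain ⟨hδ0, hδ1⟩ := hδ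
  obtain ⟨hc0, hc1⟩ := hcStar
  have hn : 0 < 2 * k := by omega
  have hn' : (0 : ℝ) < ((2 * k : ℕ) : ℝ) := by exact_mod_cast hn
  have h0 := hp₀.2.1
  have hI := bulkI_pos_of_rhoBulk_pos hα ht1 ht2 h0 hρ
  have hm₀ := (continuous_of_mem_holderClass hα hp₀.1).measurable
  have hi := hp₀.2.2.1
  have hb₀ := exists_bound_of_mem_densityClass hα hL.le (by linarith) hp₀
  have hi2 : Integrable fun x => p₀ x ^ 2 := by
    obtain ⟨V, hV⟩ := hb₀
    refine (hi.const_mul V).mono' (hm₀.pow_const 2).aestronglyMeasurable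
      (Filter.Eventually.of_forall fun x => ?_)
    rw [Real.norm_of_nonneg (sq_nonneg _), pow_two]
    exact mul_le_mul_of_nonneg_right (hV x) (h0 x)
  obtain ⟨hint, hle⟩ := hbulk (2 * k) L p₀ hn hL hm₀ h0 hi hi2 hI
  have S := bulkSetup_of_mem_densityClass hα ht2 hd hcB hK hM hn hL hc1.le hp₀ hI hc₃ hint hle
  set I := bulkI (2 * k) α t L cAux p₀ with hI_def
  set τ := sepScale d α L (2 * k : ℕ) I with hτ_def
  have hτ : 0 < τ := S.τ_pos
  have hthr : Cpsi * tThreshold (2 * k) α t L cAux Ctn p₀ = Q * τ := by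
    rw [hQ_def, mul_assoc]; rfl
  have hmom := fun (p : Space d → ℝ) (hp : p ∈ densityClass d α ((1 + δ) * L) ((1 + δ) * cStar)) =>
    S.moments_of_mem_densityClass hCK hδ0.le hδ1.le hc1 hp hk (by push_cast; ring)
  have hsplit : ENNReal.ofReal (η / 2) = ENNReal.ofReal (η / 4) + ENNReal.ofReal (η / 4) := by
    rw [← ENNReal.ofReal_add (by positivity) (by positivity)]
    congr 1
    ring
  rw [hsplit]
  refine add_le_add ?_ (iSup₂_le fun p hp => ?_)
  · have hp₀' := densityClass_mono hL.le hc0.le hδ0.le hp₀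
    have := isProbabilityMeasure_of_mem_densityClass hp₀
    have : IsProbabilityMeasure (sampleLaw (2 * k) p₀) := by unfold sampleLaw; infer_instance
    obtain ⟨hT, A, hA0, hA1, -, hVar⟩ := hmom p₀ hp₀'
    have hS0 : sqDist (weight α t p₀) p₀ p₀ (bulkTilde (2 * k) α t L cAux cB CBT p₀) = 0 := by
      simp [sqDist]
    rw [hS0, ← hC_def] at hA1 hVar
    simp only [mul_zero, zero_add, add_zero] at hA1 hVar
    rw [Real.sqrt_mul_self hτ.le] at hVar
    obtain ⟨hs, hfin⟩ := null_bound hC hη0 hτ hQ hA1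
    refine (measure_mono fun X hX => ?_).trans
      ((measure_abs_sub_ge_le hT hs hVar).trans (ENNReal.ofReal_le_ofReal hfin))
    have hlt : Q * τ < tBulk α t L cAux cB CBT K p₀ X := by
      rw [← hthr]
      by_contra hcon
      simp [psiBulk, hcon] at hX
    have hge : (Q - C) * τ ≤ tBulk α t L cAux cB CBT K p₀ X - A := by linarith
    exact hge.trans (le_abs_self _)
  · obtain ⟨hp, hsep⟩ := hp
    have := isProbabilityMeasure_of_mem_densityClass hp
    have : IsProbabilityMeasure (sampleLaw (2 * k) p) := by unfold sampleLaw; infer_instance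
    obtain ⟨hT, A, hA0, hA1, hA2, hVar⟩ := hmom p hp
    set σ := sqDist (weight α t p₀) p p₀ (bulkTilde (2 * k) α t L cAux cB CBT p₀) with hσ_def
    -- `N * (1 + c₃) + 1` was chosen to turn the separation in `L^t` into this bound.
    have hσ : N * τ ≤ σ := by
      refine S.le_sqDist_of_separated ht1 ht2
        (fun x hx => weight_rpow_mul_rpow (S.p₀_pos hx))
        (continuous_of_mem_holderClass hα hp.1).measurable hp.2.1
        (exists_bound_of_mem_densityClass hα (by positivity) ?_ hp) (by linarith) hρ.le ?_ hsep
      · nlinarith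
      · exact separation_identity hα (by linarith) ht2 hL hn' hI
    obtain ⟨hs, hfin⟩ := alternative_bound hC hQ0 hη0 hτ hN (by linarith) (by linarith) hσ hA1 hA2
    refine (measure_mono fun X hX => ?_).trans
      ((measure_abs_sub_ge_le hT hs hVar).trans (ENNReal.ofReal_le_ofReal hfin))
    have hle : tBulk α t L cAux cB CBT K p₀ X ≤ Q * τ := by
      rw [← hthr]
      simpa [psiBulk] using hX
    change A - Q * τ ≤ |tBulk α t L cAux cB CBT K p₀ X - A|
    rw [abs_sub_comm]
    refine le_trans ?_ (le_abs_self _)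
    linarith
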